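/- Let $(M,g)$ be a connected smooth Riemannian manifold (without boundary) and let $\nabla$ be a smooth metric connection on $TM$ (that is, $\nabla g=0$) whose torsion is totally skew-symmetric: $T(X,Y,Z)=g(\nabla_XY-\nabla_YX-[X,Y],Z)$ is a $3$-form. Let $R(X,Y)Z=[\nabla_X,\nabla_Y]Z-\nabla_{[X,Y]}Z$ and $R(X,Y,Z,V)=g(R(X,Y)Z,V)$ be the curvature of $\nabla$. With respect to orthonormal bases $e_1,\dots,e_n$ of the tangent spaces put $Ric(X,Y)=\sum_i R(e_i,X,Y,e_i)$, $Scal=\sum_i Ric(e_i,e_i)$ and $\|T\|^2=\sum_{i,j,k}T(e_i,e_j,e_k)^2$. Suppose that $R\in S^2\Lambda^2$, i.e. $R(X,Y,Z,V)=R(Z,V,X,Y)$ for all $X,Y,Z,V$. Then the curvature of $\nabla$ satisfies the contracted Riemannian second Bianchi identity $$d(Scal)(X)-2\sum_{i}(\nabla_{e_i}Ric)(X,e_i)=0\qquad\text{for all }X$$ if and only if $\|T\|^2$ is constant on $M$. In particular, if moreover $\nabla$ is Ricci flat, $Ric=0$, then $\|T\|^2$ is constant on $M$. -/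

import Mathlib

open Bundle Manifold
open scoped ContDiff

noncomputable section

namespace SkewTorsion

variable {E : Type*} [NormedAddCommGroup E] [NormedSpace ℝ E] [FiniteDimensional ℝ E]
  {H : Type*} [TopologicalSpace H] {I : ModelWithCorners ℝ E H}
  {M : Type*} [TopologicalSpace M] [ChartedSpace H M]

instance tangentSpace_finiteDimensional (x : M) : FiniteDimensional ℝ (TangentSpace I x) :=
  inferInstanceAs (FiniteDimensional ℝ E)

section VectorFields

variable [IsManifold I 1 M]

/-- The local extension of a tangent vector `v` at `x` to a vector field on `M`: it has constant
components in the preferred chart at `x` (so it is smooth near `x`), and its value at `x` is `v`.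
Every tensor below is evaluated on tangent vectors through such extensions; by tensoriality any
other extension that is smooth near `x` gives the same value. -/
def ext {x : M} (v : TangentSpace I x) : Π y : M, TangentSpace I y :=
  FiberBundle.extend E v

/-- The curvature operator
`R(X, Y)Z = ∇_X ∇_Y Z - ∇_Y ∇_X Z - ∇_{[X, Y]} Z` of vector fields `X`, `Y`, `Z`
(recall that `nabla Z x (X x)` is `(∇_X Z)(x)`). -/
def curvatureField (nabla : CovariantDerivative I E (TangentSpace I : M → Type _))
    (X Y Z : Π y : M, TangentSpace I y) (x : M) : TangentSpace I x :=
  nabla (fun y ↦ nabla Z y (Y y)) x (X x) - nabla (fun y ↦ nabla Z y (X y)) x (Y x)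
    - nabla Z x (VectorField.mlieBracket I X Y x)

/-- The covariant derivative `(∇_w B)(u, v) = w(B(U, V)) - B(∇_w U, v) - B(u, ∇_w V)` of a
field `B` of bilinear forms on the tangent spaces, at tangent vectors `w, u, v` at `x`, where the
vector fields `U`, `V` extend `u`, `v`. -/
def covDerivBilin (nabla : CovariantDerivative I E (TangentSpace I : M → Type _))
    (B : Π y : M, TangentSpace I y → TangentSpace I y → ℝ) (x : M)
    (w u v : TangentSpace I x) : ℝ :=
  mvfderiv I (fun y ↦ B y (ext u y) (ext v y)) x w
    - B x (nabla (ext u) x w) v - B x u (nabla (ext v) x w)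

end VectorFields

section Riemannian

variable [RiemannianBundle (fun x : M ↦ TangentSpace I x)]

/-- An orthonormal basis of the tangent space at `x`. -/
def onb (I : ModelWithCorners ℝ E H) [RiemannianBundle (fun x : M ↦ TangentSpace I x)] (x : M) :
    OrthonormalBasis (Fin (Module.finrank ℝ (TangentSpace I x))) ℝ (TangentSpace I x) :=
  stdOrthonormalBasis ℝ (TangentSpace I x)

/-- The connection is metric, `∇g = 0`: for vector fields `Y`, `Z` differentiable at `x`,
`u(g(Y, Z)) = g(∇_u Y, Z) + g(Y, ∇_u Z)`. -/
def IsMetric [IsManifold I 1 M]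
    (nabla : CovariantDerivative I E (TangentSpace I : M → Type _)) : Prop :=
  ∀ (x : M) (Y Z : Π y : M, TangentSpace I y), MDiffAt (T% Y) x → MDiffAt (T% Z) x →
    ∀ u : TangentSpace I x,
      mvfderiv I (fun y ↦ inner ℝ (Y y) (Z y)) x u
        = inner ℝ (nabla Y x u) (Z x) + inner ℝ (Y x) (nabla Z x u)

section Torsion

variable [IsManifold I 2 M]

/-- The torsion as a tensor with three lower indices: `T(u, v, w) = g(T(u, v), w)`. -/
def torsionForm (nabla : CovariantDerivative I E (TangentSpace I : M → Type _)) (x : M)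
    (u v w : TangentSpace I x) : ℝ :=
  inner ℝ (nabla.torsion x u v) w

/-- The torsion is totally skew-symmetric, i.e. `torsionForm` is a 3-form. -/
def HasSkewTorsion (nabla : CovariantDerivative I E (TangentSpace I : M → Type _)) : Prop :=
  ∀ (x : M) (u v w : TangentSpace I x),
    torsionForm nabla x u v w = -torsionForm nabla x v u w ∧
    torsionForm nabla x u v w = -torsionForm nabla x u w v

/-- `‖T‖² = ∑ T(e_i, e_j, e_k)²`, the sum running over all indices `i, j, k`. -/
def torsionNormSq (nabla : CovariantDerivative I E (TangentSpace I : M → Type _)) (x : M) : ℝ :=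
  ∑ i, ∑ j, ∑ k, torsionForm nabla x (onb I x i) (onb I x j) (onb I x k) ^ 2

end Torsion

section Curvature

variable [IsManifold I 1 M]

/-- The curvature tensor `R(u, v, w, z) = g(R(u, v)w, z)`. -/
def curvature (nabla : CovariantDerivative I E (TangentSpace I : M → Type _)) (x : M)
    (u v w z : TangentSpace I x) : ℝ :=
  inner ℝ (curvatureField nabla (ext u) (ext v) (ext w) x) z

/-- `R ∈ S²Λ²`: the curvature is pair symmetric, `R(u, v, w, z) = R(w, z, u, v)`. -/
def CurvaturePairSymmetric
    (nabla : CovariantDerivative I E (TangentSpace I : M → Type _)) : Prop :=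
  ∀ (x : M) (u v w z : TangentSpace I x),
    curvature nabla x u v w z = curvature nabla x w z u v

/-- The Ricci tensor `Ric(u, v) = ∑ R(e_i, u, v, e_i)`. -/
def ricci (nabla : CovariantDerivative I E (TangentSpace I : M → Type _)) (x : M)
    (u v : TangentSpace I x) : ℝ :=
  ∑ i, curvature nabla x (onb I x i) u v (onb I x i)

/-- The scalar curvature `Scal = ∑ Ric(e_i, e_i)`. -/
def scal (nabla : CovariantDerivative I E (TangentSpace I : M → Type _)) (x : M) : ℝ :=
  ∑ i, ricci nabla x (onb I x i) (onb I x i)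

/-- The contracted Riemannian second Bianchi identity
`d(Scal)(u) - 2 ∑ (∇_{e_i} Ric)(u, e_i) = 0`. -/
def ContractedSecondBianchi
    (nabla : CovariantDerivative I E (TangentSpace I : M → Type _)) : Prop :=
  ∀ (x : M) (u : TangentSpace I x),
    mvfderiv I (scal nabla) x u
      - 2 * ∑ i, covDerivBilin nabla (ricci nabla) x (onb I x i) u (onb I x i) = 0

/-- The connection is Ricci flat: `Ric = 0`. -/
def RicciFlat (nabla : CovariantDerivative I E (TangentSpace I : M → Type _)) : Prop :=
  ∀ (x : M) (u v : TangentSpace I x), ricci nabla x u v = 0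

end Curvature

end Riemannian

end SkewTorsion

end

/-
The Jacobi identity gives the two Bianchi identities with torsion. For skew torsion and `∇g = 0`,
`R ∈ S²Λ²`, the first one forces `∇T` to be a `4`-form (Ivanov); contracting it with `T` gives
`∑ T(eᵢ, eⱼ, eₖ) R(eᵢ, eⱼ, eₖ, X) = -∑ T(eᵢ, eⱼ, eₖ) (∇_X T)(eᵢ, eⱼ, eₖ) = -½ d‖T‖²(X)`.
The left side is also the torsion term in the twice contracted second Bianchi identity, so
`d Scal(X) - 2 ∑ (∇_{eᵢ} Ric)(X, eᵢ)` is a nonzero multiple of `d‖T‖²(X)`.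
-/

noncomputable section

namespace SkewTorsion

open Filter Topology VectorField

section MinSmoothness

variable {E : Type*} [NormedAddCommGroup E] [NormedSpace ℝ E]
  {H : Type*} [TopologicalSpace H] {I : ModelWithCorners ℝ E H}
  {M : Type*} [TopologicalSpace M] [ChartedSpace H M] [IsManifold I ∞ M]

lemma isManifold_minSmoothness_two : IsManifold I (minSmoothness ℝ 2) M := by
  simpa using! (inferInstance : IsManifold I 2 M)

lemma isManifold_minSmoothness_three : IsManifold I (minSmoothness ℝ 3) M := by
  simpa using! (inferInstance : IsManifold I 3 M)

end MinSmoothness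

attribute [local instance] isManifold_minSmoothness_two isManifold_minSmoothness_three

section SmoothFunctions

variable {E : Type*} [NormedAddCommGroup E] [NormedSpace ℝ E]
  {H : Type*} [TopologicalSpace H] {I : ModelWithCorners ℝ E H}
  {M : Type*} [TopologicalSpace M] [ChartedSpace H M] {x : M} {f g : M → ℝ}

lemma mvfderiv_congr {F : Type*} [NormedAddCommGroup F] [NormedSpace ℝ F] {f g : M → F}
    (h : f =ᶠ[𝓝 x] g) : mvfderiv I f x = mvfderiv I g x := by
  ext v
  simp only [mvfderiv, h.mfderiv_eq]
  rfl

variable (I) in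
/-- The function `f` is smooth on a neighbourhood of `x`. -/
def SmoothFunNear (x : M) (f : M → ℝ) : Prop :=
  ∀ᶠ y in 𝓝 x, CMDiffAt ∞ f y

namespace SmoothFunNear

lemma contMDiffAt (hf : SmoothFunNear I x f) : CMDiffAt ∞ f x := hf.self_of_nhds

lemma mdifferentiableAt (hf : SmoothFunNear I x f) : MDiffAt f x :=
  hf.contMDiffAt.mdifferentiableAt (by simp)

lemma eventually (hf : SmoothFunNear I x f) : ∀ᶠ y in 𝓝 x, SmoothFunNear I y f :=
  eventually_eventually_nhds.2 hf

lemma congr (hf : SmoothFunNear I x f) (h : g =ᶠ[𝓝 x] f) : SmoothFunNear I x g := by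
  filter_upwards [hf, h.eventuallyEq_nhds] with y hf_y h_y using hf_y.congr_of_eventuallyEq h_y

lemma const (c : ℝ) : SmoothFunNear I x (fun _ ↦ c) := .of_forall fun _ ↦ contMDiffAt_const

lemma mul (hf : SmoothFunNear I x f) (hg : SmoothFunNear I x g) : SmoothFunNear I x (f * g) := by
  filter_upwards [hf, hg] with y hf_y hg_y using hf_y.mul hg_y

lemma sum {ι : Type*} {s : Finset ι} {f : ι → M → ℝ} (hf : ∀ i ∈ s, SmoothFunNear I x (f i)) :
    SmoothFunNear I x (fun y ↦ ∑ i ∈ s, f i y) := by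
  filter_upwards [(Finset.eventually_all s).2 hf] with y h using contMDiffAt_finsetSum h

lemma inv₀ (hf : SmoothFunNear I x f) (h : f x ≠ 0) : SmoothFunNear I x (f⁻¹) := by
  filter_upwards [hf, hf.contMDiffAt.continuousAt.eventually_ne h]
    with y hf_y ne_zero using hf_y.inv₀ ne_zero

lemma sqrt (hf : SmoothFunNear I x f) (h : f x ≠ 0) :
    SmoothFunNear I x (fun y ↦ Real.sqrt (f y)) := by
  filter_upwards [hf, hf.contMDiffAt.continuousAt.eventually_ne h] with y hf_y ne_zero
  exact (Real.contDiffAt_sqrt ne_zero).contMDiffAt.comp y hf_y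

end SmoothFunNear

lemma mvfderiv_sum {ι : Type*} {s : Finset ι} {f : ι → M → ℝ}
    (hf : ∀ i ∈ s, SmoothFunNear I x (f i)) :
    mvfderiv I (fun y ↦ ∑ i ∈ s, f i y) x = ∑ i ∈ s, mvfderiv I (f i) x := by
  classical
  induction s using Finset.induction_on with
  | empty => simpa using! mvfderiv_const (I := I) (0 : ℝ)
  | insert a s ha ih =>
    rw [Finset.forall_mem_insert] at hf
    simp only [Finset.sum_insert ha, ← ih hf.2]
    exact mvfderiv_add hf.1.mdifferentiableAt (SmoothFunNear.sum hf.2).mdifferentiableAt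

end SmoothFunctions

section SmoothFields

variable {E : Type*} [NormedAddCommGroup E] [NormedSpace ℝ E]
  {H : Type*} [TopologicalSpace H] {I : ModelWithCorners ℝ E H}
  {M : Type*} [TopologicalSpace M] [ChartedSpace H M] [IsManifold I ∞ M]
  {x : M} {X Y : Π y : M, TangentSpace I y} {f : M → ℝ}

@[simp] lemma ext_self (v : TangentSpace I x) : ext v x = v := FiberBundle.extend_apply_self ..

/-- The vector field `X` is smooth on a neighbourhood of `x`. -/
def SmoothNear (x : M) (X : Π y : M, TangentSpace I y) : Prop :=
  ∀ᶠ y in 𝓝 x, CMDiffAt ∞ (T% X) y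

namespace SmoothNear

lemma contMDiffAt (hX : SmoothNear x X) : CMDiffAt ∞ (T% X) x := hX.self_of_nhds

lemma mdifferentiableAt (hX : SmoothNear x X) : MDiffAt (T% X) x :=
  hX.contMDiffAt.mdifferentiableAt (by simp)

lemma eventually (hX : SmoothNear x X) : ∀ᶠ y in 𝓝 x, SmoothNear y X :=
  eventually_eventually_nhds.2 hX

lemma congr (hX : SmoothNear x X) (h : ∀ᶠ y in 𝓝 x, Y y = X y) : SmoothNear x Y := by
  filter_upwards [hX, h.eventually_nhds] with y hX_y h_y
  exact hX_y.congr_of_eventuallyEq (h_y.mono fun z hz ↦ by simp [hz])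

lemma zero : SmoothNear x (0 : Π y : M, TangentSpace I y) :=
  .of_forall fun _ ↦ (contMDiff_zeroSection ℝ (TangentSpace I : M → Type _)).contMDiffAt

lemma add (hX : SmoothNear x X) (hY : SmoothNear x Y) : SmoothNear x (X + Y) := by
  filter_upwards [hX, hY] with y hX_y hY_y using hX_y.add_section hY_y

lemma sub (hX : SmoothNear x X) (hY : SmoothNear x Y) : SmoothNear x (X - Y) := by
  filter_upwards [hX, hY] with y hX_y hY_y using hX_y.sub_section hY_y

lemma smul (hf : SmoothFunNear I x f) (hX : SmoothNear x X) : SmoothNear x (f • X) := by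
  filter_upwards [hf, hX] with y hf_y hX_y using hf_y.smul_section hX_y

lemma sum {ι : Type*} {s : Finset ι} {F : ι → Π y : M, TangentSpace I y}
    (hF : ∀ i ∈ s, SmoothNear x (F i)) : SmoothNear x (fun y ↦ ∑ i ∈ s, F i y) := by
  filter_upwards [(Finset.eventually_all s).2 hF] with y h using ContMDiffAt.sum_section h

lemma ext (v : TangentSpace I x) : SmoothNear x (ext v) := by
  obtain ⟨s, hs, h⟩ := FiberBundle.exists_contMDiffOn_extend (k := ∞) I E v
  filter_upwards [eventually_mem_nhds_iff.2 hs] with y hy using h.contMDiffAt hy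

lemma mlieBracket [CompleteSpace E] (hX : SmoothNear x X) (hY : SmoothNear x Y) :
    SmoothNear x (VectorField.mlieBracket I X Y) := by
  filter_upwards [hX, hY] with y hX_y hY_y
  have : IsManifold I (((⊤ : ℕ∞) : ℕ∞ω) + 1) M := by
    simpa using! (inferInstance : IsManifold I ∞ M)
  exact ContMDiffAt.mlieBracket_vectorField (n := ⊤) (m := ⊤) hX_y hY_y (by simp)

lemma inner [RiemannianBundle (fun x : M ↦ TangentSpace I x)]
    [IsContMDiffRiemannianBundle I ∞ E (fun x : M ↦ TangentSpace I x)]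
    (hX : SmoothNear x X) (hY : SmoothNear x Y) :
    SmoothFunNear I x (fun y ↦ inner ℝ (X y) (Y y)) := by
  filter_upwards [hX, hY] with y hX_y hY_y
  exact ContMDiffAt.inner_bundle (E := fun y : M ↦ TangentSpace I y) (b := fun y ↦ y) hX_y hY_y

variable [FiniteDimensional ℝ E] [T2Space M]

lemma exists_contMDiff (hX : SmoothNear x X) :
    ∃ Y : Π y : M, TangentSpace I y, CMDiff ∞ (T% Y) ∧ ∀ᶠ y in 𝓝 x, Y y = X y := by
  obtain ⟨u, hu, huo, hxu⟩ := eventually_nhds_iff.1 hX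
  obtain ⟨χ, -, hχ⟩ := (SmoothBumpFunction.nhds_basis_tsupport (I := I) x).mem_iff.1
    (huo.mem_nhds hxu)
  refine ⟨(χ : M → ℝ) • X, ?_, ?_⟩
  · exact ContMDiffOn.smul_section_of_tsupport χ.contMDiff.contMDiffOn huo hχ
      fun y hy ↦ (hu y hy).contMDiffWithinAt
  · filter_upwards [χ.eventuallyEq_one] with y hy
    simp [hy]

lemma covDeriv {nabla : CovariantDerivative I E (TangentSpace I : M → Type _)}
    (hn : nabla.ContMDiffCovariantDerivative ∞) (hX : SmoothNear x X) (hY : SmoothNear x Y) :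
    SmoothNear x (fun y ↦ nabla Y y (X y)) := by
  obtain ⟨Y', hY', h⟩ := hY.exists_contMDiff
  have smooth_global := hn.contMDiff.contMDiff (σ := Y') (by simpa using! hY'.contMDiffOn)
  have smooth_covDeriv : SmoothNear x (fun y ↦ nabla Y' y (X y)) := by
    filter_upwards [hX] with y hX_y
    exact ContMDiffAt.clm_bundle_apply
      ((smooth_global y (Set.mem_univ _)).contMDiffAt Filter.univ_mem) hX_y
  refine smooth_covDeriv.congr ?_
  filter_upwards [hY.eventually, h.eventually_nhds] with y hY_y h_y
  rw [nabla.isCovariantDerivativeOn.congr_of_eventuallyEq hY_y.mdifferentiableAt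
    (hY_y.congr h_y).mdifferentiableAt Filter.univ_mem (h_y.mono fun _ h ↦ h.symm)]

end SmoothNear

end SmoothFields

section Derivations

variable {E : Type*} [NormedAddCommGroup E] [NormedSpace ℝ E]
  {H : Type*} [TopologicalSpace H] {I : ModelWithCorners ℝ E H}
  {M : Type*} [TopologicalSpace M] [ChartedSpace H M] [IsManifold I ∞ M]
  {x : M} {X Y Z : Π y : M, TangentSpace I y} {f : M → ℝ}

lemma SmoothFunNear.deriv (hf : SmoothFunNear I x f) (hX : SmoothNear x X) :
    SmoothFunNear I x (fun y ↦ mvfderiv I f y (X y)) := by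
  obtain ⟨s, hs, hso, hxs⟩ := eventually_nhds_iff.1 hf
  have smooth_tangentMap :=
    ContMDiffOn.contMDiffOn_tangentMapWithin (m := ∞) (n := ∞)
      (fun y hy ↦ (hs y hy).contMDiffWithinAt) le_rfl hso.uniqueMDiffOn
  filter_upwards [hso.mem_nhds hxs, hX] with y hy h
  have smooth_comp := (smooth_tangentMap.contMDiffAt (x := (⟨y, X y⟩ : TangentBundle I M))
    ((hso.preimage (FiberBundle.continuous_proj E (TangentSpace I))).mem_nhds hy)).comp y h
  refine ((contMDiff_snd_tangentBundle_modelSpace ℝ 𝓘(ℝ, ℝ)).contMDiffAt.comp y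
    smooth_comp).congr_of_eventuallyEq ?_
  filter_upwards [hso.mem_nhds hy] with z hz
  change mfderiv I 𝓘(ℝ, ℝ) f z (X z) = mfderivWithin I 𝓘(ℝ, ℝ) f s z (X z)
  rw [mfderivWithin_of_isOpen hso hz]

variable [CompleteSpace E]

lemma mlieBracket_mlieBracket_smul (hf : SmoothFunNear I x f) (hY : SmoothNear x Y)
    (hZ : SmoothNear x Z) :
    mlieBracket I X (mlieBracket I Y (f • Z)) x
      = mvfderiv I (fun y ↦ mvfderiv I f y (Y y)) x (X x) • Z x
        + mvfderiv I f x (Y x) • mlieBracket I X Z x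
        + mvfderiv I f x (X x) • mlieBracket I Y Z x
        + f x • mlieBracket I X (mlieBracket I Y Z) x := by
  have leibniz : mlieBracket I Y (f • Z) =ᶠ[𝓝 x]
      (fun y ↦ mvfderiv I f y (Y y)) • Z + f • mlieBracket I Y Z := by
    filter_upwards [hf.eventually, hZ.eventually] with y hf_y hZ_y
    exact mlieBracket_smul_right hf_y.mdifferentiableAt hZ_y.mdifferentiableAt
  have hd := hf.deriv hY
  rw [(EventuallyEq.refl _ X).mlieBracket_vectorField_eq leibniz,
    mlieBracket_add_right (SmoothNear.smul hd hZ).mdifferentiableAt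
      (SmoothNear.smul hf (hY.mlieBracket hZ)).mdifferentiableAt,
    mlieBracket_smul_right hd.mdifferentiableAt hZ.mdifferentiableAt,
    mlieBracket_smul_right hf.mdifferentiableAt (hY.mlieBracket hZ).mdifferentiableAt]
  abel

lemma mlieBracket_leibniz (hX : SmoothNear x X) (hY : SmoothNear x Y) (hZ : SmoothNear x Z) :
    mlieBracket I X (mlieBracket I Y Z) x
      = mlieBracket I (mlieBracket I X Y) Z x + mlieBracket I Y (mlieBracket I X Z) x := by
  have h : minSmoothness ℝ 2 ≤ ∞ := by simpa using! ENat.LEInfty.out (m := 2)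
  exact leibniz_identity_mlieBracket_apply (hX.contMDiffAt.of_le h) (hY.contMDiffAt.of_le h)
    (hZ.contMDiffAt.of_le h)

end Derivations

section LieDerivative

variable {E : Type*} [NormedAddCommGroup E] [NormedSpace ℝ E] [CompleteSpace E]
  {H : Type*} [TopologicalSpace H] {I : ModelWithCorners ℝ E H}
  {M : Type*} [TopologicalSpace M] [ChartedSpace H M] [IsManifold I ∞ M]
  {x : M} {X Y : Π y : M, TangentSpace I y} {f : M → ℝ}

/- Both sides are read off as coefficients of `Z x` in the Jacobi identity for `X`, `Y` and
`f • Z`, where `Z` is any field with `Z x ≠ 0`. -/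
lemma mvfderiv_mlieBracket (hf : SmoothFunNear I x f) (hX : SmoothNear x X)
    (hY : SmoothNear x Y) :
    mvfderiv I f x (mlieBracket I X Y x)
      = mvfderiv I (fun y ↦ mvfderiv I f y (Y y)) x (X x)
        - mvfderiv I (fun y ↦ mvfderiv I f y (X y)) x (Y x) := by
  rcases subsingleton_or_nontrivial (TangentSpace I x) with _ | _
  · simp [Subsingleton.elim (X x) 0, Subsingleton.elim (Y x) 0,
      Subsingleton.elim (mlieBracket I X Y x) 0]
  obtain ⟨z, hz⟩ := exists_ne (0 : TangentSpace I x)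
  have hZ := SmoothNear.ext z
  have leibniz_smul := mlieBracket_leibniz hX hY (.smul hf hZ)
  rw [mlieBracket_mlieBracket_smul hf hY hZ, mlieBracket_mlieBracket_smul hf hX hZ,
    mlieBracket_smul_right hf.mdifferentiableAt hZ.mdifferentiableAt, ext_self,
    mlieBracket_leibniz hX hY hZ, ← sub_eq_zero] at leibniz_smul
  have coeff : (mvfderiv I f x (mlieBracket I X Y x)
      - (mvfderiv I (fun y ↦ mvfderiv I f y (Y y)) x (X x)
        - mvfderiv I (fun y ↦ mvfderiv I f y (X y)) x (Y x))) • z = 0 := by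
    rw [← neg_eq_zero, ← leibniz_smul]
    module
  exact sub_eq_zero.1 ((smul_eq_zero.1 coeff).resolve_right hz)

end LieDerivative

section Tensoriality

variable {E : Type*} [NormedAddCommGroup E] [NormedSpace ℝ E]
  {H : Type*} [TopologicalSpace H] {I : ModelWithCorners ℝ E H}
  {M : Type*} [TopologicalSpace M] [ChartedSpace H M] [IsManifold I ∞ M]
  {A : Type*} [AddCommGroup A] [Module ℝ A]
  {Φ : (Π y : M, TangentSpace I y) → A} {x : M} {X Y : Π y : M, TangentSpace I y}

/-- The operation `Φ` on vector fields is additive and linear over germs of smooth functions, on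
the fields that are smooth near `x`. The analogue of `TensorialAt` for operations, such as the
curvature, which involve second derivatives. -/
structure SmoothTensorialAt (Φ : (Π y : M, TangentSpace I y) → A) (x : M) : Prop where
  add : ∀ {X Y}, SmoothNear x X → SmoothNear x Y → Φ (X + Y) = Φ X + Φ Y
  smul : ∀ {f X}, SmoothFunNear I x f → SmoothNear x X → Φ (f • X) = f x • Φ X

namespace SmoothTensorialAt

lemma congr_of_eventuallyEq (hΦ : SmoothTensorialAt Φ x) (hX : SmoothNear x X)
    (hY : SmoothNear x Y) (h : ∀ᶠ y in 𝓝 x, X y = Y y) : Φ X = Φ Y := by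
  classical
  let ψ : M → ℝ := fun y ↦ if X y = Y y then 1 else 0
  have hψ : SmoothFunNear I x ψ :=
    (SmoothFunNear.const 1).congr (h.mono fun y hy ↦ by simp [ψ, hy])
  have hψx : ψ x = 1 := by simp [ψ, h.self_of_nhds]
  have smul_eq : ψ • X = ψ • Y := by
    funext y
    by_cases hy : X y = Y y <;> simp [ψ, hy]
  simpa [hΦ.smul hψ hX, hΦ.smul hψ hY, hψx] using congrArg Φ smul_eq

lemma zero (hΦ : SmoothTensorialAt Φ x) : Φ 0 = 0 := by
  simpa using hΦ.smul (.const 0) SmoothNear.zero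

lemma sub (hΦ : SmoothTensorialAt Φ x) (hX : SmoothNear x X) (hY : SmoothNear x Y) :
    Φ (X - Y) = Φ X - Φ Y := by
  rw [eq_sub_iff_add_eq, ← hΦ.add (hX.sub hY) hY, sub_add_cancel]

lemma sum (hΦ : SmoothTensorialAt Φ x) {ι : Type*} {s : Finset ι}
    {F : ι → Π y : M, TangentSpace I y} (hF : ∀ i ∈ s, SmoothNear x (F i)) :
    Φ (fun y ↦ ∑ i ∈ s, F i y) = ∑ i ∈ s, Φ (F i) := by
  classical
  induction s using Finset.induction_on with
  | empty => simpa using! hΦ.zero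
  | insert a s ha ih =>
    rw [Finset.forall_mem_insert] at hF
    simp only [Finset.sum_insert ha, ← ih hF.2]
    exact hΦ.add hF.1 (.sum hF.2)

lemma pointwise [FiniteDimensional ℝ E] (hΦ : SmoothTensorialAt Φ x) (hX : SmoothNear x X)
    (hY : SmoothNear x Y) (h : X x = Y x) : Φ X = Φ Y := by
  let t := trivializationAt E (TangentSpace I : M → Type _) x
  have hx : x ∈ t.baseSet := FiberBundle.mem_baseSet_trivializationAt E _ x
  let b := Module.finBasis ℝ E
  let c := t.localFrameCoeff I b
  have smooth_frame : ∀ i, SmoothNear x (t.localFrame b i) := fun i ↦ by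
    filter_upwards [t.open_baseSet.mem_nhds hx] with y hy
    exact contMDiffAt_localFrame_of_mem ∞ t b i hy
  have expand : ∀ {X : Π y : M, TangentSpace I y}, SmoothNear x X →
      Φ X = ∑ i, c i x (X x) • Φ (t.localFrame b i) := by
    intro X hX
    have smooth_coeff : ∀ i, SmoothFunNear I x (LinearMap.piApply (c i) X) := fun i ↦ by
      filter_upwards [t.open_baseSet.mem_nhds hx, hX] with y hy h
      exact contMDiffAt_localFrameCoeff b hy h i
    have smooth_term : ∀ i ∈ Finset.univ,
        SmoothNear x ((LinearMap.piApply (c i) X : M → ℝ) • t.localFrame b i) :=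
      fun i _ ↦ .smul (smooth_coeff i) (smooth_frame i)
    rw [hΦ.congr_of_eventuallyEq hX (.sum smooth_term)
      (t.eventually_eq_localFrame_sum_coeff_smul b hx), hΦ.sum smooth_term]
    exact Finset.sum_congr rfl fun i _ ↦ hΦ.smul (smooth_coeff i) (smooth_frame i)
  rw [expand hX, expand hY, h]

lemma isLinearMap_ext [FiniteDimensional ℝ E] (hΦ : SmoothTensorialAt Φ x) :
    IsLinearMap ℝ (fun u : TangentSpace I x ↦ Φ (ext u)) where
  map_add u v := by
    rw [← hΦ.add (.ext u) (.ext v)]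
    exact hΦ.pointwise (.ext _) (.add (.ext u) (.ext v)) (by simp)
  map_smul c u := by
    rw [← hΦ.smul (.const c) (.ext u)]
    exact hΦ.pointwise (.ext _) (.smul (.const c) (.ext u)) (by simp)

end SmoothTensorialAt

end Tensoriality

section CovariantDerivative

variable {E : Type*} [NormedAddCommGroup E] [NormedSpace ℝ E]
  {H : Type*} [TopologicalSpace H] {I : ModelWithCorners ℝ E H}
  {M : Type*} [TopologicalSpace M] [ChartedSpace H M] [IsManifold I ∞ M]
  {x : M} {X Y Z : Π y : M, TangentSpace I y} {f : M → ℝ}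
  {nabla : CovariantDerivative I E (TangentSpace I : M → Type _)}

lemma covDeriv_congr (hX : SmoothNear x X) (h : ∀ᶠ y in 𝓝 x, Y y = X y) :
    nabla Y x = nabla X x :=
  nabla.isCovariantDerivativeOn.congr_of_eventuallyEq (hX.congr h).mdifferentiableAt
    hX.mdifferentiableAt Filter.univ_mem h

lemma covDeriv_add (hX : SmoothNear x X) (hY : SmoothNear x Y) :
    nabla (X + Y) x = nabla X x + nabla Y x :=
  nabla.isCovariantDerivativeOn.add (s := Set.univ) hX.mdifferentiableAt hY.mdifferentiableAt

lemma covDeriv_sub (hX : SmoothNear x X) (hY : SmoothNear x Y) :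
    nabla (X - Y) x = nabla X x - nabla Y x := by
  rw [eq_sub_iff_add_eq, ← covDeriv_add (hX.sub hY) hY, sub_add_cancel]

lemma covDeriv_neg (hX : SmoothNear x X) : nabla (-X) x = -nabla X x := by
  rw [← zero_sub, covDeriv_sub .zero hX, nabla.isCovariantDerivativeOn.zero (s := Set.univ),
    zero_sub]

lemma covDeriv_smul (hf : SmoothFunNear I x f) (hX : SmoothNear x X) (v : TangentSpace I x) :
    nabla (f • X) x v = f x • nabla X x v + mvfderiv I f x v • X x := by
  rw [nabla.isCovariantDerivativeOn.leibniz (s := Set.univ) hX.mdifferentiableAt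
    hf.mdifferentiableAt]
  rfl

lemma curvatureField_swap : curvatureField nabla X Y Z x = -curvatureField nabla Y X Z x := by
  rw [curvatureField, mlieBracket_swap_apply, map_neg, curvatureField]
  abel

end CovariantDerivative

section Curvature

variable {E : Type*} [NormedAddCommGroup E] [NormedSpace ℝ E] [FiniteDimensional ℝ E]
  {H : Type*} [TopologicalSpace H] {I : ModelWithCorners ℝ E H}
  {M : Type*} [TopologicalSpace M] [T2Space M] [ChartedSpace H M] [IsManifold I ∞ M]
  {x : M} {X X' Y Y' Z Z' : Π y : M, TangentSpace I y} {f : M → ℝ}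
  {nabla : CovariantDerivative I E (TangentSpace I : M → Type _)}
  (hn : nabla.ContMDiffCovariantDerivative ∞)

include hn

lemma covDeriv_covDeriv_add (hY : SmoothNear x Y) (hZ : SmoothNear x Z) (hZ' : SmoothNear x Z') :
    nabla (fun y ↦ nabla (Z + Z') y (Y y)) x
      = nabla (fun y ↦ nabla Z y (Y y)) x + nabla (fun y ↦ nabla Z' y (Y y)) x := by
  have hYZ := SmoothNear.covDeriv hn hY hZ
  have hYZ' := SmoothNear.covDeriv hn hY hZ'
  rw [← covDeriv_add hYZ hYZ']
  refine covDeriv_congr (hYZ.add hYZ') ?_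
  filter_upwards [hZ.eventually, hZ'.eventually] with y hZ_y hZ'_y
  rw [covDeriv_add hZ_y hZ'_y]
  rfl

lemma covDeriv_covDeriv_smul (hf : SmoothFunNear I x f) (hY : SmoothNear x Y)
    (hZ : SmoothNear x Z) (u : TangentSpace I x) :
    nabla (fun y ↦ nabla (f • Z) y (Y y)) x u
      = f x • nabla (fun y ↦ nabla Z y (Y y)) x u
        + mvfderiv I f x u • nabla Z x (Y x) + mvfderiv I f x (Y x) • nabla Z x u
        + mvfderiv I (fun y ↦ mvfderiv I f y (Y y)) x u • Z x := by
  have leibniz : ∀ᶠ y in 𝓝 x, nabla (f • Z) y (Y y)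
      = (f • (fun y ↦ nabla Z y (Y y)) + (fun y ↦ mvfderiv I f y (Y y)) • Z) y := by
    filter_upwards [hf.eventually, hZ.eventually] with y hf_y hZ_y
    rw [covDeriv_smul hf_y hZ_y]
    rfl
  have hYZ := SmoothNear.covDeriv hn hY hZ
  have hfZ := SmoothNear.smul (hf.deriv hY) hZ
  rw [covDeriv_congr ((SmoothNear.smul hf hYZ).add hfZ) leibniz, covDeriv_add (.smul hf hYZ) hfZ,
    add_apply, covDeriv_smul hf hYZ, covDeriv_smul (hf.deriv hY) hZ]
  abel

lemma SmoothNear.curvatureField (hX : SmoothNear x X) (hY : SmoothNear x Y)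
    (hZ : SmoothNear x Z) : SmoothNear x (curvatureField nabla X Y Z) :=
  ((SmoothNear.covDeriv hn hX (.covDeriv hn hY hZ)).sub
    (.covDeriv hn hY (.covDeriv hn hX hZ))).sub (.covDeriv hn (hX.mlieBracket hY) hZ)

lemma smoothTensorialAt_curvatureField_left (hZ : SmoothNear x Z) :
    SmoothTensorialAt (fun X ↦ curvatureField nabla X Y Z x) x where
  add {X X'} hX hX' := by
    have second_deriv : nabla (fun y ↦ nabla Z y ((X + X') y)) x
        = nabla (fun y ↦ nabla Z y (X y)) x + nabla (fun y ↦ nabla Z y (X' y)) x := by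
      rw [← covDeriv_add (SmoothNear.covDeriv hn hX hZ) (SmoothNear.covDeriv hn hX' hZ)]
      congr 1
      ext y
      simp
    rw [SkewTorsion.curvatureField, second_deriv,
      mlieBracket_add_left hX.mdifferentiableAt hX'.mdifferentiableAt]
    simp only [SkewTorsion.curvatureField, add_apply, Pi.add_apply, map_add]
    abel
  smul {f X} hf hX := by
    have second_deriv : nabla (fun y ↦ nabla Z y ((f • X) y)) x (Y x)
        = f x • nabla (fun y ↦ nabla Z y (X y)) x (Y x)
          + mvfderiv I f x (Y x) • nabla Z x (X x) := by
      rw [← covDeriv_smul hf (SmoothNear.covDeriv hn hX hZ)]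
      congr 2
      ext y
      simp
    rw [SkewTorsion.curvatureField, second_deriv,
      mlieBracket_smul_left hf.mdifferentiableAt hX.mdifferentiableAt]
    simp only [SkewTorsion.curvatureField, Pi.smul_apply', map_add, map_smul]
    module

lemma smoothTensorialAt_curvatureField_right (hX : SmoothNear x X) (hY : SmoothNear x Y) :
    SmoothTensorialAt (fun Z ↦ curvatureField nabla X Y Z x) x where
  add hZ hZ' := by
    simp only [SkewTorsion.curvatureField, covDeriv_covDeriv_add hn hX hZ hZ',
      covDeriv_covDeriv_add hn hY hZ hZ', covDeriv_add hZ hZ', add_apply]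
    abel
  smul hf hZ := by
    simp only [SkewTorsion.curvatureField, covDeriv_covDeriv_smul hn hf hX hZ,
      covDeriv_covDeriv_smul hn hf hY hZ, covDeriv_smul hf hZ, mvfderiv_mlieBracket hf hX hY]
    module

lemma curvatureField_congr (hX : SmoothNear x X) (hY : SmoothNear x Y) (hZ : SmoothNear x Z)
    (hX' : SmoothNear x X') (hY' : SmoothNear x Y') (hZ' : SmoothNear x Z')
    (hXX : X x = X' x) (hYY : Y x = Y' x) (hZZ : Z x = Z' x) :
    curvatureField nabla X Y Z x = curvatureField nabla X' Y' Z' x :=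
  calc curvatureField nabla X Y Z x
    _ = curvatureField nabla X' Y Z x :=
      (smoothTensorialAt_curvatureField_left hn hZ).pointwise hX hX' hXX
    _ = -curvatureField nabla Y X' Z x := curvatureField_swap
    _ = -curvatureField nabla Y' X' Z x := by
      rw [(smoothTensorialAt_curvatureField_left hn hZ).pointwise hY hY' hYY]
    _ = curvatureField nabla X' Y' Z x := curvatureField_swap.symm
    _ = curvatureField nabla X' Y' Z' x :=
      (smoothTensorialAt_curvatureField_right hn hX' hY').pointwise hZ hZ' hZZ

end Curvature

section Bianchi

variable {E : Type*} [NormedAddCommGroup E] [NormedSpace ℝ E] [FiniteDimensional ℝ E]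
  {H : Type*} [TopologicalSpace H] {I : ModelWithCorners ℝ E H}
  {M : Type*} [TopologicalSpace M] [ChartedSpace H M] [IsManifold I ∞ M]
  {x : M} {X Y Z W : Π y : M, TangentSpace I y}
  {nabla : CovariantDerivative I E (TangentSpace I : M → Type _)}

lemma mlieBracket_jacobi (hX : SmoothNear x X) (hY : SmoothNear x Y) (hZ : SmoothNear x Z) :
    mlieBracket I (mlieBracket I X Y) Z x + mlieBracket I (mlieBracket I Y Z) X x
      + mlieBracket I (mlieBracket I Z X) Y x = 0 := by
  have leibniz := mlieBracket_leibniz hX hY hZ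
  have swap_twice :
      mlieBracket I Y (mlieBracket I X Z) x = mlieBracket I (mlieBracket I Z X) Y x := by
    rw [mlieBracket_swap_apply, mlieBracket_swap (V := X), ← neg_one_smul ℝ (mlieBracket I Z X),
      mlieBracket_const_smul_left (hZ.mlieBracket hX).mdifferentiableAt]
    simp
  rw [mlieBracket_swap_apply, swap_twice] at leibniz
  rw [add_right_comm, ← leibniz, neg_add_cancel]

variable (nabla) in
/-- The covariant derivative `(∇_X T)(Y, Z)` of the torsion `T`, along vector fields. -/
def covDerivTorsion (X Y Z : Π y : M, TangentSpace I y) (x : M) : TangentSpace I x :=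
  nabla (fun y ↦ nabla.torsion y (Y y) (Z y)) x (X x)
    - nabla.torsion x (nabla Y x (X x)) (Z x) - nabla.torsion x (Y x) (nabla Z x (X x))

variable (nabla) in
/-- The covariant derivative `(∇_X R)(Y, Z)W` of the curvature `R`, along vector fields. -/
def covDerivCurvature (X Y Z W : Π y : M, TangentSpace I y) (x : M) : TangentSpace I x :=
  nabla (curvatureField nabla Y Z W) x (X x)
    - curvatureField nabla (fun y ↦ nabla Y y (X y)) Z W x
    - curvatureField nabla Y (fun y ↦ nabla Z y (X y)) W x
    - curvatureField nabla Y Z (fun y ↦ nabla W y (X y)) x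

lemma torsion_apply (hX : SmoothNear x X) (hY : SmoothNear x Y) :
    nabla.torsion x (X x) (Y x) = nabla Y x (X x) - nabla X x (Y x) - mlieBracket I X Y x :=
  nabla.torsion_apply hX.mdifferentiableAt hY.mdifferentiableAt

variable [T2Space M] (hn : nabla.ContMDiffCovariantDerivative ∞)

include hn

lemma SmoothNear.torsion (hX : SmoothNear x X) (hY : SmoothNear x Y) :
    SmoothNear x (fun y ↦ nabla.torsion y (X y) (Y y)) := by
  refine (((SmoothNear.covDeriv hn hX hY).sub (.covDeriv hn hY hX)).sub
    (hX.mlieBracket hY)).congr ?_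
  filter_upwards [hX.eventually, hY.eventually] with y hX_y hY_y using torsion_apply hX_y hY_y

lemma covDerivTorsion_swap (hY : SmoothNear x Y) (hZ : SmoothNear x Z) :
    covDerivTorsion nabla X Y Z x = -covDerivTorsion nabla X Z Y x := by
  have swap : (fun y ↦ nabla.torsion y (Y y) (Z y)) = -fun y ↦ nabla.torsion y (Z y) (Y y) :=
    funext fun y ↦ nabla.torsion_antisymm (Y y) (Z y)
  rw [covDerivTorsion, swap, covDeriv_neg (.torsion hn hZ hY),
    nabla.torsion_antisymm (nabla Y x (X x)), nabla.torsion_antisymm (Y x), covDerivTorsion]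
  simp only [neg_apply]
  abel

lemma covDerivCurvature_swap (hY : SmoothNear x Y) (hZ : SmoothNear x Z) (hW : SmoothNear x W) :
    covDerivCurvature nabla X Y Z W x = -covDerivCurvature nabla X Z Y W x := by
  have swap : curvatureField nabla Y Z W = -curvatureField nabla Z Y W :=
    funext fun y ↦ curvatureField_swap
  simp only [covDerivCurvature, swap, covDeriv_neg (.curvatureField hn hZ hY hW), neg_apply,
    curvatureField_swap (X := Y), curvatureField_swap (X := fun y ↦ nabla Y y (X y))]
  abel

lemma covDeriv_torsion (hX : SmoothNear x X) (hY : SmoothNear x Y) (hZ : SmoothNear x Z) :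
    nabla (fun y ↦ nabla.torsion y (Y y) (Z y)) x (X x)
      = nabla (fun y ↦ nabla Z y (Y y)) x (X x) - nabla (fun y ↦ nabla Y y (Z y)) x (X x)
        - nabla X x (mlieBracket I Y Z x) + mlieBracket I (mlieBracket I Y Z) X x
        + nabla.torsion x (nabla Z x (Y x) - nabla Y x (Z x)) (X x)
        - nabla.torsion x (nabla.torsion x (Y x) (Z x)) (X x) := by
  have hYZ := SmoothNear.covDeriv hn hY hZ
  have hZY := SmoothNear.covDeriv hn hZ hY
  have hbracket := hY.mlieBracket hZ
  have torsion_eq : ∀ᶠ y in 𝓝 x, nabla.torsion y (Y y) (Z y)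
      = ((fun y ↦ nabla Z y (Y y)) - (fun y ↦ nabla Y y (Z y)) - mlieBracket I Y Z) y := by
    filter_upwards [hY.eventually, hZ.eventually] with y hY_y hZ_y using torsion_apply hY_y hZ_y
  have mlieBracket_eq : mlieBracket I Y Z x
      = nabla Z x (Y x) - nabla Y x (Z x) - nabla.torsion x (Y x) (Z x) := by
    rw [torsion_apply hY hZ]
    abel
  have torsion_mlieBracket := torsion_apply (nabla := nabla) hbracket hX
  nth_rw 1 [mlieBracket_eq] at torsion_mlieBracket
  rw [map_sub, sub_apply] at torsion_mlieBracket
  rw [covDeriv_congr ((hYZ.sub hZY).sub hbracket) torsion_eq, covDeriv_sub (hYZ.sub hZY) hbracket,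
    covDeriv_sub hYZ hZY, add_sub_assoc, torsion_mlieBracket, sub_apply, sub_apply]
  abel

lemma firstBianchi (hX : SmoothNear x X) (hY : SmoothNear x Y) (hZ : SmoothNear x Z) :
    curvatureField nabla X Y Z x + curvatureField nabla Y Z X x + curvatureField nabla Z X Y x
      = covDerivTorsion nabla X Y Z x + nabla.torsion x (nabla.torsion x (X x) (Y x)) (Z x)
        + (covDerivTorsion nabla Y Z X x + nabla.torsion x (nabla.torsion x (Y x) (Z x)) (X x))
        + (covDerivTorsion nabla Z X Y x
          + nabla.torsion x (nabla.torsion x (Z x) (X x)) (Y x)) := by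
  simp only [covDerivTorsion, covDeriv_torsion hn hX hY hZ, covDeriv_torsion hn hY hZ hX,
    covDeriv_torsion hn hZ hX hY, curvatureField, map_sub, sub_apply]
  rw [nabla.torsion_antisymm (Y x) (nabla Z x (X x)),
    nabla.torsion_antisymm (Z x) (nabla X x (Y x)), nabla.torsion_antisymm (X x) (nabla Y x (Z x))]
  linear_combination (norm := module) -mlieBracket_jacobi hX hY hZ

lemma covDeriv_curvatureField (hX : SmoothNear x X) (hY : SmoothNear x Y)
    (hZ : SmoothNear x Z) (u : TangentSpace I x) :
    nabla (curvatureField nabla X Y Z) x u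
      = nabla (fun y ↦ nabla (fun y ↦ nabla Z y (Y y)) y (X y)) x u
        - nabla (fun y ↦ nabla (fun y ↦ nabla Z y (X y)) y (Y y)) x u
        - nabla (fun y ↦ nabla Z y (mlieBracket I X Y y)) x u := by
  have hXYZ := SmoothNear.covDeriv hn hX (.covDeriv hn hY hZ)
  have hYXZ := SmoothNear.covDeriv hn hY (.covDeriv hn hX hZ)
  have hbracketZ := SmoothNear.covDeriv hn (hX.mlieBracket hY) hZ
  rw [← sub_apply, ← sub_apply, ← covDeriv_sub hXYZ hYXZ, ← covDeriv_sub (hXYZ.sub hYXZ) hbracketZ]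
  rfl

lemma curvatureField_mlieBracket (hX : SmoothNear x X) (hY : SmoothNear x Y)
    (hW : SmoothNear x W) :
    curvatureField nabla (mlieBracket I X Y) Z W x
      = curvatureField nabla (fun y ↦ nabla Y y (X y)) Z W x
        - curvatureField nabla (fun y ↦ nabla X y (Y y)) Z W x
        - curvatureField nabla (fun y ↦ nabla.torsion y (X y) (Y y)) Z W x := by
  have hΦ := smoothTensorialAt_curvatureField_left (Y := Z) hn hW
  have hXY := SmoothNear.covDeriv hn hX hY
  have hYX := SmoothNear.covDeriv hn hY hX
  have htorsion := SmoothNear.torsion hn hX hY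
  rw [← hΦ.sub hXY hYX, ← hΦ.sub (hXY.sub hYX) htorsion]
  refine hΦ.pointwise (hX.mlieBracket hY) ((hXY.sub hYX).sub htorsion) ?_
  simp [torsion_apply hX hY]

lemma secondBianchi_mlieBracket (hX : SmoothNear x X) (hY : SmoothNear x Y)
    (hZ : SmoothNear x Z) (hW : SmoothNear x W) :
    nabla (curvatureField nabla Y Z W) x (X x)
        - curvatureField nabla Y Z (fun y ↦ nabla W y (X y)) x
        - curvatureField nabla (mlieBracket I X Y) Z W x
      + (nabla (curvatureField nabla Z X W) x (Y x)
        - curvatureField nabla Z X (fun y ↦ nabla W y (Y y)) x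
        - curvatureField nabla (mlieBracket I Y Z) X W x)
      + (nabla (curvatureField nabla X Y W) x (Z x)
        - curvatureField nabla X Y (fun y ↦ nabla W y (Z y)) x
        - curvatureField nabla (mlieBracket I Z X) Y W x) = 0 := by
  have jacobi := congrArg (nabla W x) (mlieBracket_jacobi hX hY hZ)
  simp only [map_add, map_zero] at jacobi
  rw [covDeriv_curvatureField hn hY hZ hW, covDeriv_curvatureField hn hZ hX hW,
    covDeriv_curvatureField hn hX hY hW]
  simp only [curvatureField]
  linear_combination (norm := module) jacobi

lemma secondBianchi (hX : SmoothNear x X) (hY : SmoothNear x Y) (hZ : SmoothNear x Z)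
    (hW : SmoothNear x W) :
    covDerivCurvature nabla X Y Z W x
        + curvatureField nabla (fun y ↦ nabla.torsion y (X y) (Y y)) Z W x
      + (covDerivCurvature nabla Y Z X W x
        + curvatureField nabla (fun y ↦ nabla.torsion y (Y y) (Z y)) X W x)
      + (covDerivCurvature nabla Z X Y W x
        + curvatureField nabla (fun y ↦ nabla.torsion y (Z y) (X y)) Y W x) = 0 := by
  have bianchi := secondBianchi_mlieBracket hn hX hY hZ hW
  rw [curvatureField_mlieBracket hn hX hY hW, curvatureField_mlieBracket hn hY hZ hW,
    curvatureField_mlieBracket hn hZ hX hW] at bianchi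
  rw [covDerivCurvature, covDerivCurvature, covDerivCurvature,
    curvatureField_swap (X := Y) (Y := fun y ↦ nabla Z y (X y)),
    curvatureField_swap (X := Z) (Y := fun y ↦ nabla X y (Y y)),
    curvatureField_swap (X := X) (Y := fun y ↦ nabla Y y (Z y))]
  linear_combination (norm := module) bianchi

end Bianchi

section OrthonormalBases

variable {V W : Type*} [NormedAddCommGroup V] [InnerProductSpace ℝ V]
  [NormedAddCommGroup W] [InnerProductSpace ℝ W]
  {ι κ : Type*} [Fintype ι] [Fintype κ] (B : V →ₗ[ℝ] V →ₗ[ℝ] ℝ) (f : V →ₗ[ℝ] W)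
  (b : OrthonormalBasis ι ℝ V) (c : OrthonormalBasis κ ℝ V)

lemma map_eq_sum_inner_smul (v : V) : f v = ∑ i, inner ℝ (b i) v • f (b i) := by
  conv_lhs => rw [← b.sum_repr' v, map_sum]
  simp only [map_smul]

lemma sum_bilin_orthonormalBasis_eq : ∑ j, B (c j) (c j) = ∑ i, B (b i) (b i) :=
  calc ∑ j, B (c j) (c j)
    _ = ∑ j, ∑ i, inner ℝ (b i) (c j) * B (b i) (c j) :=
      Finset.sum_congr rfl fun j _ ↦ map_eq_sum_inner_smul (B.flip (c j)) b (c j)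
    _ = ∑ i, ∑ j, inner ℝ (c j) (b i) * B (b i) (c j) := by
      rw [Finset.sum_comm]
      simp only [real_inner_comm]
    _ = ∑ i, B (b i) (b i) :=
      Finset.sum_congr rfl fun i _ ↦ (map_eq_sum_inner_smul (B (b i)) c (b i)).symm

lemma sum_norm_sq_orthonormalBasis_eq : ∑ j, ‖f (c j)‖ ^ 2 = ∑ i, ‖f (b i)‖ ^ 2 := by
  simpa using! sum_bilin_orthonormalBasis_eq ((innerₗ W).compl₁₂ f f) b c

lemma sum_bilin_eq_zero_of_skew {D : ι → V}
    (hD : ∀ i j, inner ℝ (b j) (D i) = -inner ℝ (b i) (D j)) :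
    ∑ i, (B (D i) (b i) + B (b i) (D i)) = 0 := by
  have left : ∑ i, B (D i) (b i) = -∑ i, ∑ j, inner ℝ (b j) (D i) * B (b i) (b j) :=
    calc ∑ i, B (D i) (b i)
      _ = ∑ i, ∑ j, inner ℝ (b j) (D i) * B (b j) (b i) :=
        Finset.sum_congr rfl fun i _ ↦ map_eq_sum_inner_smul (B.flip (b i)) b (D i)
      _ = ∑ i, ∑ j, -(inner ℝ (b j) (D i) * B (b i) (b j)) := by
        rw [Finset.sum_comm]
        exact Finset.sum_congr rfl fun i _ ↦ Finset.sum_congr rfl fun j _ ↦ by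
          rw [hD, neg_mul]
      _ = -∑ i, ∑ j, inner ℝ (b j) (D i) * B (b i) (b j) := by
        simp only [Finset.sum_neg_distrib]
  have right : ∑ i, B (b i) (D i) = ∑ i, ∑ j, inner ℝ (b j) (D i) * B (b i) (b j) :=
    Finset.sum_congr rfl fun i _ ↦ map_eq_sum_inner_smul (B (b i)) b (D i)
  rw [Finset.sum_add_distrib, left, right, neg_add_cancel]

lemma sum_inner_map_eq_zero_of_skew {D : ι → V}
    (hD : ∀ i j, inner ℝ (b j) (D i) = -inner ℝ (b i) (D j)) :
    ∑ i, inner ℝ (f (D i)) (f (b i)) = 0 := by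
  have h := sum_bilin_eq_zero_of_skew ((innerₗ W).compl₁₂ f f) b hD
  simp only [LinearMap.compl₁₂_apply, innerₗ_apply_apply, real_inner_comm (f (D _)),
    ← two_mul, ← Finset.mul_sum] at h
  simpa [real_inner_comm] using h

end OrthonormalBases

section Frames

variable {E : Type*} [NormedAddCommGroup E] [NormedSpace ℝ E]
  {H : Type*} [TopologicalSpace H] {I : ModelWithCorners ℝ E H}
  {M : Type*} [TopologicalSpace M] [ChartedSpace H M] [IsManifold I ∞ M]
  [RiemannianBundle (fun x : M ↦ TangentSpace I x)]
  {x : M} {ι : Type*}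

open InnerProductSpace in
lemma SmoothNear.gramSchmidt [IsContMDiffRiemannianBundle I ∞ E (fun x : M ↦ TangentSpace I x)]
    [LinearOrder ι] [LocallyFiniteOrderBot ι] [WellFoundedLT ι]
    {X : ι → Π y : M, TangentSpace I y} (hX : ∀ i, SmoothNear x (X i))
    (h : LinearIndependent ℝ (fun i ↦ X i x)) (i : ι) :
    SmoothNear x (fun y ↦ gramSchmidt ℝ (fun j ↦ X j y) i) := by
  induction i using WellFoundedLT.induction with
  | ind i ih =>
    let G : ι → Π y : M, TangentSpace I y := fun j y ↦ InnerProductSpace.gramSchmidt ℝ (X · y) j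
    let coeff : ι → M → ℝ :=
      fun j ↦ (fun y ↦ Inner.inner ℝ (G j y) (X i y)) * (fun y ↦ Inner.inner ℝ (G j y) (G j y))⁻¹
    have smooth_coeff : ∀ j < i, SmoothFunNear I x (coeff j) := fun j hj ↦
      ((ih j hj).inner (hX i)).mul
        (((ih j hj).inner (ih j hj)).inv₀ (inner_self_ne_zero.2 (gramSchmidt_ne_zero j h)))
    refine ((hX i).sub (.sum fun j (hj : j ∈ Finset.Iio i) ↦
      .smul (smooth_coeff j (Finset.mem_Iio.1 hj)) (ih j (Finset.mem_Iio.1 hj)))).congr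
      (.of_forall fun y ↦ ?_)
    simp only [gramSchmidt_def ℝ _ i, Submodule.starProjection_singleton, Pi.sub_apply,
      Pi.smul_apply', Pi.mul_apply, Pi.inv_apply, real_inner_self_eq_norm_sq, div_eq_mul_inv,
      coeff, G]
    rfl

lemma SmoothNear.normalize [IsContMDiffRiemannianBundle I ∞ E (fun x : M ↦ TangentSpace I x)]
    {X : Π y : M, TangentSpace I y} (hX : SmoothNear x X) (h : X x ≠ 0) :
    SmoothNear x (fun y ↦ ‖X y‖⁻¹ • X y) := by
  have norm_eq : (fun y ↦ Real.sqrt (Inner.inner ℝ (X y) (X y))) = fun y ↦ ‖X y‖ :=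
    funext fun y ↦ (norm_eq_sqrt_real_inner (X y)).symm
  have smooth_norm : SmoothFunNear I x (fun y ↦ ‖X y‖) :=
    norm_eq ▸ (hX.inner hX).sqrt (inner_self_ne_zero.2 h)
  exact .smul (smooth_norm.inv₀ (norm_ne_zero_iff.2 h)) hX

variable [Fintype ι]

/-- The vector fields `F i` form a smooth orthonormal frame of the tangent bundle on a
neighbourhood of `x`. -/
structure OrthonormalFrameNear (x : M) (F : ι → Π y : M, TangentSpace I y) : Prop where
  smooth : ∀ i, SmoothNear x (F i)
  orthonormal : ∀ᶠ y in 𝓝 x, ∃ b : OrthonormalBasis ι ℝ (TangentSpace I y), ∀ i, b i = F i y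

open InnerProductSpace in
lemma exists_orthonormalFrameNear [FiniteDimensional ℝ E]
    [IsContMDiffRiemannianBundle I ∞ E (fun x : M ↦ TangentSpace I x)]
    [LinearOrder ι] [LocallyFiniteOrderBot ι] [WellFoundedLT ι]
    (b : OrthonormalBasis ι ℝ (TangentSpace I x)) :
    ∃ F : ι → Π y : M, TangentSpace I y, OrthonormalFrameNear x F ∧ ∀ i, F i x = b i := by
  let G : ι → Π y : M, TangentSpace I y := fun i y ↦ gramSchmidt ℝ (fun j ↦ ext (b j) y) i
  have ext_basis : (fun j ↦ ext (b j) x) = b := funext fun j ↦ ext_self (b j)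
  have hG : ∀ i, SmoothNear x (G i) := .gramSchmidt (fun j ↦ .ext (b j)) (by
    rw [ext_basis]
    exact b.orthonormal.linearIndependent)
  have G_self : ∀ i, G i x = b i := fun i ↦ by
    simp only [G, ext_basis]
    rw [gramSchmidt_of_orthogonal ℝ b.orthonormal.2]
  have G_ne_zero : ∀ i, G i x ≠ 0 := fun i ↦ by
    rw [G_self]
    exact b.orthonormal.ne_zero i
  have hF : ∀ i, SmoothNear x (fun y ↦ ‖G i y‖⁻¹ • G i y) := fun i ↦ (hG i).normalize (G_ne_zero i)
  refine ⟨fun i y ↦ ‖G i y‖⁻¹ • G i y, ⟨hF, ?_⟩, fun i ↦ by simp [G_self]⟩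
  have eventually_ne : ∀ᶠ y in 𝓝 x, ∀ i, Inner.inner ℝ (G i y) (G i y) ≠ (0 : ℝ) :=
    eventually_all.2 fun i ↦ ((hG i).inner (hG i)).contMDiffAt.continuousAt.eventually_ne
      (inner_self_ne_zero.2 (G_ne_zero i))
  filter_upwards [eventually_ne] with y hy
  have card_eq : Module.finrank ℝ (TangentSpace I y) = Fintype.card ι :=
    Module.finrank_eq_card_basis b.toBasis
  refine ⟨gramSchmidtOrthonormalBasis card_eq fun j ↦ ext (b j) y, fun i ↦ ?_⟩
  have hi : G i y ≠ 0 := inner_self_ne_zero.1 (hy i)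
  exact gramSchmidtOrthonormalBasis_apply card_eq (by simpa [gramSchmidtNormed, G] using hi)

namespace OrthonormalFrameNear

variable {F : ι → Π y : M, TangentSpace I y}

lemma inner_covDeriv_skew (hF : OrthonormalFrameNear x F)
    {nabla : CovariantDerivative I E (TangentSpace I : M → Type _)} (hmetric : IsMetric nabla)
    (u : TangentSpace I x) (i j : ι) :
    inner ℝ (F j x) (nabla (F i) x u) = -inner ℝ (F i x) (nabla (F j) x u) := by
  classical
  have leibniz := hmetric x (F i) (F j) (hF.smooth i).mdifferentiableAt
    (hF.smooth j).mdifferentiableAt u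
  have inner_eventuallyEq :
      (fun y ↦ inner ℝ (F i y) (F j y)) =ᶠ[𝓝 x] fun _ ↦ (if i = j then 1 else 0 : ℝ) := by
    filter_upwards [hF.orthonormal] with y ⟨b, hb⟩
    rw [← hb, ← hb, b.inner_eq_ite]
  rw [mvfderiv_congr inner_eventuallyEq, mvfderiv_const, zero_apply,
    real_inner_comm] at leibniz
  exact eq_neg_of_add_eq_zero_left leibniz.symm

end OrthonormalFrameNear

end Frames

section Tensors

variable {E : Type*} [NormedAddCommGroup E] [NormedSpace ℝ E] [FiniteDimensional ℝ E]
  {H : Type*} [TopologicalSpace H] {I : ModelWithCorners ℝ E H}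
  {M : Type*} [TopologicalSpace M] [T2Space M] [ChartedSpace H M] [IsManifold I ∞ M]
  [RiemannianBundle (fun x : M ↦ TangentSpace I x)]
  {x : M} {U X Y Z W : Π y : M, TangentSpace I y}
  {nabla : CovariantDerivative I E (TangentSpace I : M → Type _)}
  (hn : nabla.ContMDiffCovariantDerivative ∞)

include hn

lemma curvature_eq_inner (hX : SmoothNear x X) (hY : SmoothNear x Y) (hZ : SmoothNear x Z)
    (w : TangentSpace I x) :
    curvature nabla x (X x) (Y x) (Z x) w = inner ℝ (curvatureField nabla X Y Z x) w := by
  rw [curvature, curvatureField_congr hn (.ext _) (.ext _) (.ext _) hX hY hZ (ext_self _)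
    (ext_self _) (ext_self _)]

lemma curvature_eventuallyEq (hX : SmoothNear x X) (hY : SmoothNear x Y) (hZ : SmoothNear x Z) :
    (fun y ↦ curvature nabla y (X y) (Y y) (Z y) (W y))
      =ᶠ[𝓝 x] fun y ↦ inner ℝ (curvatureField nabla X Y Z y) (W y) := by
  filter_upwards [hX.eventually, hY.eventually, hZ.eventually] with y hX_y hY_y hZ_y
  exact curvature_eq_inner hn hX_y hY_y hZ_y (W y)

lemma SmoothNear.curvature [IsContMDiffRiemannianBundle I ∞ E (fun x : M ↦ TangentSpace I x)]
    (hX : SmoothNear x X) (hY : SmoothNear x Y) (hZ : SmoothNear x Z) (hW : SmoothNear x W) :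
    SmoothFunNear I x (fun y ↦ curvature nabla y (X y) (Y y) (Z y) (W y)) :=
  ((SmoothNear.curvatureField hn hX hY hZ).inner hW).congr (curvature_eventuallyEq hn hX hY hZ)

lemma isBilinearMap_curvature_outer (v w : TangentSpace I x) :
    IsBilinearMap ℝ (fun u z ↦ curvature nabla x u v w z) :=
  have left := (smoothTensorialAt_curvatureField_left (Y := SkewTorsion.ext v) hn
    (.ext w)).isLinearMap_ext
  { add_left := fun u u' z ↦ by simp only [curvature, left.map_add, inner_add_left]
    smul_left := fun c u z ↦ by simp only [curvature, left.map_smul, real_inner_smul_left,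
      smul_eq_mul]
    add_right := fun u z z' ↦ inner_add_right ..
    smul_right := fun c u z ↦ real_inner_smul_right .. }

lemma isBilinearMap_curvature_inner (u z : TangentSpace I x) :
    IsBilinearMap ℝ (fun v w ↦ curvature nabla x u v w z) :=
  have left := fun w : TangentSpace I x ↦ (smoothTensorialAt_curvatureField_left
    (Y := SkewTorsion.ext u) hn (.ext w)).isLinearMap_ext
  have right := fun v : TangentSpace I x ↦ (smoothTensorialAt_curvatureField_right hn
    (.ext u) (.ext v)).isLinearMap_ext
  { add_left := fun v v' w ↦ by
      simp only [curvature, curvatureField_swap (X := SkewTorsion.ext u), (left w).map_add, neg_add,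
        inner_add_left]
    smul_left := fun c v w ↦ by
      simp only [curvature, curvatureField_swap (X := SkewTorsion.ext u), (left w).map_smul,
        ← smul_neg, real_inner_smul_left, smul_eq_mul]
    add_right := fun v w w' ↦ by simp only [curvature, (right v).map_add, inner_add_left]
    smul_right := fun c v w ↦ by
      simp only [curvature, (right v).map_smul, real_inner_smul_left, smul_eq_mul] }

variable (hmetric : IsMetric nabla)

include hmetric

lemma inner_covDerivTorsion (hX : SmoothNear x X) (hY : SmoothNear x Y) (hZ : SmoothNear x Z) :
    inner ℝ (covDerivTorsion nabla U X Y x) (Z x)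
      = mvfderiv I (fun y ↦ torsionForm nabla y (X y) (Y y) (Z y)) x (U x)
        - torsionForm nabla x (nabla X x (U x)) (Y x) (Z x)
        - torsionForm nabla x (X x) (nabla Y x (U x)) (Z x)
        - torsionForm nabla x (X x) (Y x) (nabla Z x (U x)) := by
  have leibniz := hmetric x _ Z (SmoothNear.torsion hn hX hY).mdifferentiableAt
    hZ.mdifferentiableAt (U x)
  simp only [torsionForm, leibniz, covDerivTorsion, inner_sub_left]
  ring

lemma inner_covDerivCurvature (hU : SmoothNear x U) (hX : SmoothNear x X) (hY : SmoothNear x Y)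
    (hZ : SmoothNear x Z) (hW : SmoothNear x W) :
    inner ℝ (covDerivCurvature nabla U X Y Z x) (W x)
      = mvfderiv I (fun y ↦ curvature nabla y (X y) (Y y) (Z y) (W y)) x (U x)
        - curvature nabla x (nabla X x (U x)) (Y x) (Z x) (W x)
        - curvature nabla x (X x) (nabla Y x (U x)) (Z x) (W x)
        - curvature nabla x (X x) (Y x) (nabla Z x (U x)) (W x)
        - curvature nabla x (X x) (Y x) (Z x) (nabla W x (U x)) := by
  have leibniz := hmetric x _ W (SmoothNear.curvatureField hn hX hY hZ).mdifferentiableAt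
    hW.mdifferentiableAt (U x)
  rw [mvfderiv_congr (curvature_eventuallyEq hn hX hY hZ), leibniz, covDerivCurvature,
    curvature_eq_inner hn (.covDeriv hn hU hX) hY hZ,
    curvature_eq_inner hn hX (.covDeriv hn hU hY) hZ,
    curvature_eq_inner hn hX hY (.covDeriv hn hU hZ), curvature_eq_inner hn hX hY hZ]
  simp only [inner_sub_left]
  ring

lemma HasSkewTorsion.inner_covDerivTorsion_swap (hT : HasSkewTorsion nabla)
    (hX : SmoothNear x X) (hY : SmoothNear x Y) (hZ : SmoothNear x Z) :
    inner ℝ (covDerivTorsion nabla U X Y x) (Z x)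
      = -inner ℝ (covDerivTorsion nabla U X Z x) (Y x) := by
  have swap : (fun y ↦ torsionForm nabla y (X y) (Y y) (Z y))
      = -fun y ↦ torsionForm nabla y (X y) (Z y) (Y y) := funext fun y ↦ (hT y _ _ _).2
  rw [inner_covDerivTorsion hn hmetric hX hY hZ, inner_covDerivTorsion hn hmetric hX hZ hY, swap,
    mvfderiv_neg, neg_apply, (hT x (nabla X x (U x)) _ _).2, (hT x _ (nabla Y x (U x)) _).2,
    (hT x _ _ (nabla Z x (U x))).2]
  ring

lemma CurvaturePairSymmetric.inner_covDerivCurvature_comm (hR : CurvaturePairSymmetric nabla)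
    (hU : SmoothNear x U) (hX : SmoothNear x X) (hY : SmoothNear x Y) (hZ : SmoothNear x Z)
    (hW : SmoothNear x W) :
    inner ℝ (covDerivCurvature nabla U X Y Z x) (W x)
      = inner ℝ (covDerivCurvature nabla U Z W X x) (Y x) := by
  have comm : (fun y ↦ curvature nabla y (X y) (Y y) (Z y) (W y))
      = fun y ↦ curvature nabla y (Z y) (W y) (X y) (Y y) := funext fun y ↦ hR y _ _ _ _
  rw [inner_covDerivCurvature hn hmetric hU hX hY hZ hW,
    inner_covDerivCurvature hn hmetric hU hZ hW hX hY, comm, hR x (nabla X x (U x)),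
    hR x _ (nabla Y x (U x)), hR x _ _ (nabla Z x (U x)), hR x _ _ _ (nabla W x (U x))]
  ring

end Tensors

section BilinearForms

variable {E : Type*} [NormedAddCommGroup E] [NormedSpace ℝ E]
  {H : Type*} [TopologicalSpace H] {I : ModelWithCorners ℝ E H}
  {M : Type*} [TopologicalSpace M] [ChartedSpace H M] [IsManifold I ∞ M]
  {x : M} {B : Π y : M, TangentSpace I y → TangentSpace I y → ℝ}

/-- `B` is a smooth field of bilinear forms near `x`: its values on vector fields that are smooth
near `x` are smooth near `x`. -/
structure SmoothBilinNear (x : M) (B : Π y : M, TangentSpace I y → TangentSpace I y → ℝ) :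
    Prop where
  bilin : ∀ y, IsBilinearMap ℝ (B y)
  smooth : ∀ {X Y}, SmoothNear x X → SmoothNear x Y → SmoothFunNear I x (fun y ↦ B y (X y) (Y y))

namespace SmoothBilinNear

lemma flip (hB : SmoothBilinNear x B) : SmoothBilinNear x (fun y u v ↦ B y v u) where
  bilin y :=
    { add_left := fun u v w ↦ (hB.bilin y).add_right w u v
      smul_left := fun c u v ↦ (hB.bilin y).smul_right c v u
      add_right := fun u v w ↦ (hB.bilin y).add_left v w u
      smul_right := fun c u v ↦ (hB.bilin y).smul_left c v u }
  smooth hX hY := hB.smooth hY hX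

variable {nabla : CovariantDerivative I E (TangentSpace I : M → Type _)}
  {X Y : Π y : M, TangentSpace I y}

lemma smoothTensorialAt_covDeriv (hB : SmoothBilinNear x B) (hY : SmoothNear x Y)
    (u : TangentSpace I x) :
    SmoothTensorialAt (fun X ↦ mvfderiv I (fun y ↦ B y (X y) (Y y)) x u
      - B x (nabla X x u) (Y x) - B x (X x) (nabla Y x u)) x where
  add {X X'} hX hX' := by
    have add_eq : (fun y ↦ B y ((X + X') y) (Y y))
        = (fun y ↦ B y (X y) (Y y)) + fun y ↦ B y (X' y) (Y y) :=
      funext fun y ↦ (hB.bilin y).add_left ..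
    rw [add_eq, mvfderiv_add (hB.smooth hX hY).mdifferentiableAt
      (hB.smooth hX' hY).mdifferentiableAt, covDeriv_add hX hX']
    simp only [add_apply, Pi.add_apply, (hB.bilin x).add_left]
    ring
  smul {f X} hf hX := by
    have smul_eq : (fun y ↦ B y ((f • X) y) (Y y)) = f * fun y ↦ B y (X y) (Y y) :=
      funext fun y ↦ (hB.bilin y).smul_left ..
    rw [smul_eq, mvfderiv_mul hf.mdifferentiableAt (hB.smooth hX hY).mdifferentiableAt,
      covDeriv_smul hf hX]
    simp only [add_apply, smul_apply, Pi.smul_apply', smul_eq_mul, (hB.bilin x).add_left,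
      (hB.bilin x).smul_left]
    ring

variable [FiniteDimensional ℝ E]

lemma covDerivBilin_apply (hB : SmoothBilinNear x B) (hX : SmoothNear x X) (hY : SmoothNear x Y)
    (u : TangentSpace I x) :
    covDerivBilin nabla B x u (X x) (Y x)
      = mvfderiv I (fun y ↦ B y (X y) (Y y)) x u
        - B x (nabla X x u) (Y x) - B x (X x) (nabla Y x u) := by
  have left := (hB.smoothTensorialAt_covDeriv (nabla := nabla) hY u).pointwise hX (.ext (X x))
    (ext_self _).symm
  have right := (hB.flip.smoothTensorialAt_covDeriv (nabla := nabla) (.ext (X x)) u).pointwise hY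
    (.ext (Y x)) (ext_self _).symm
  simp only [ext_self] at left right
  rw [left, covDerivBilin]
  linarith

lemma isLinearMap_covDerivBilin (hB : SmoothBilinNear x B) (u w : TangentSpace I x) :
    IsLinearMap ℝ (fun v ↦ covDerivBilin nabla B x u v w) := by
  simpa only [covDerivBilin, ext_self] using
    (hB.smoothTensorialAt_covDeriv (nabla := nabla) (.ext w) u).isLinearMap_ext

end SmoothBilinNear

variable [FiniteDimensional ℝ E] [RiemannianBundle (fun x : M ↦ TangentSpace I x)]
  {ι : Type*} [Fintype ι] {F : ι → Π y : M, TangentSpace I y}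
  {nabla : CovariantDerivative I E (TangentSpace I : M → Type _)}

lemma OrthonormalFrameNear.mvfderiv_trace (hF : OrthonormalFrameNear x F)
    (hmetric : IsMetric nabla) (hB : SmoothBilinNear x B) (u : TangentSpace I x) :
    mvfderiv I (fun y ↦ ∑ i, B y (F i y) (F i y)) x u
      = ∑ i, covDerivBilin nabla B x u (F i x) (F i x) := by
  obtain ⟨b, hb⟩ := hF.orthonormal.self_of_nhds
  have rotation : ∑ i, (B x (nabla (F i) x u) (F i x) + B x (F i x) (nabla (F i) x u)) = 0 := by
    have skew := hF.inner_covDeriv_skew hmetric u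
    simp only [← hb] at skew ⊢
    exact sum_bilin_eq_zero_of_skew (hB.bilin x).toLinearMap b skew
  simp only [hB.covDerivBilin_apply (hF.smooth _) (hF.smooth _), sub_sub, Finset.sum_sub_distrib,
    rotation, sub_zero, mvfderiv_sum fun i _ ↦ hB.smooth (hF.smooth i) (hF.smooth i), sum_apply]

end BilinearForms

section Contractions

variable {E : Type*} [NormedAddCommGroup E] [NormedSpace ℝ E] [FiniteDimensional ℝ E]
  {H : Type*} [TopologicalSpace H] {I : ModelWithCorners ℝ E H}
  {M : Type*} [TopologicalSpace M] [ChartedSpace H M] [IsManifold I ∞ M]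
  [RiemannianBundle (fun x : M ↦ TangentSpace I x)]
  {x : M} {U X Y : Π y : M, TangentSpace I y} {ι : Type*} [Fintype ι]
  {F : ι → Π y : M, TangentSpace I y}
  {nabla : CovariantDerivative I E (TangentSpace I : M → Type _)}

lemma torsionNormSq_eq_sum (b : OrthonormalBasis ι ℝ (TangentSpace I x)) :
    torsionNormSq nabla x = ∑ i, ∑ j, ‖nabla.torsion x (b i) (b j)‖ ^ 2 := by
  let τ := (nabla.torsion x).toLinearMap₁₂
  calc torsionNormSq nabla x
    _ = ∑ i, ∑ j, ‖nabla.torsion x (onb I x i) (onb I x j)‖ ^ 2 := by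
      simp only [torsionNormSq, torsionForm, OrthonormalBasis.sum_sq_inner_left]
    _ = ∑ i, ∑ j, ‖nabla.torsion x (onb I x i) (b j)‖ ^ 2 :=
      Finset.sum_congr rfl fun i _ ↦
        sum_norm_sq_orthonormalBasis_eq (τ (onb I x i)) b (onb I x)
    _ = ∑ i, ∑ j, ‖nabla.torsion x (b i) (b j)‖ ^ 2 := by
      rw [Finset.sum_comm]
      conv_rhs => rw [Finset.sum_comm]
      exact Finset.sum_congr rfl fun j _ ↦
        sum_norm_sq_orthonormalBasis_eq (τ.flip (b j)) b (onb I x)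

section Ricci

variable [T2Space M] (hn : nabla.ContMDiffCovariantDerivative ∞)

include hn

lemma ricci_eq_sum (b : OrthonormalBasis ι ℝ (TangentSpace I x)) (u v : TangentSpace I x) :
    ricci nabla x u v = ∑ i, curvature nabla x (b i) u v (b i) :=
  sum_bilin_orthonormalBasis_eq (isBilinearMap_curvature_outer hn u v).toLinearMap b (onb I x)

lemma isBilinearMap_ricci : IsBilinearMap ℝ (ricci nabla x) where
  add_left u u' v := by
    simp only [ricci, (isBilinearMap_curvature_inner hn _ _).add_left, Finset.sum_add_distrib]
  smul_left c u v := by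
    simp only [ricci, (isBilinearMap_curvature_inner hn _ _).smul_left, Finset.smul_sum]
  add_right u v v' := by
    simp only [ricci, (isBilinearMap_curvature_inner hn _ _).add_right, Finset.sum_add_distrib]
  smul_right c u v := by
    simp only [ricci, (isBilinearMap_curvature_inner hn _ _).smul_right, Finset.smul_sum]

lemma scal_eq_sum (b : OrthonormalBasis ι ℝ (TangentSpace I x)) :
    scal nabla x = ∑ i, ricci nabla x (b i) (b i) :=
  sum_bilin_orthonormalBasis_eq (isBilinearMap_ricci hn).toLinearMap b (onb I x)

lemma OrthonormalFrameNear.ricci_eventuallyEq (hF : OrthonormalFrameNear x F) :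
    (fun y ↦ ricci nabla y (X y) (Y y))
      =ᶠ[𝓝 x] fun y ↦ ∑ i, curvature nabla y (F i y) (X y) (Y y) (F i y) := by
  filter_upwards [hF.orthonormal] with y ⟨b, hb⟩
  simp only [ricci_eq_sum hn b, hb]

lemma OrthonormalFrameNear.scal_eventuallyEq (hF : OrthonormalFrameNear x F) :
    scal nabla =ᶠ[𝓝 x] fun y ↦ ∑ i, ricci nabla y (F i y) (F i y) := by
  filter_upwards [hF.orthonormal] with y ⟨b, hb⟩
  simp only [scal_eq_sum hn b, hb]

variable [IsContMDiffRiemannianBundle I ∞ E (fun x : M ↦ TangentSpace I x)]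

lemma smoothBilinNear_curvature_outer (hX : SmoothNear x X) (hY : SmoothNear x Y) :
    SmoothBilinNear x (fun y u v ↦ curvature nabla y u (X y) (Y y) v) where
  bilin y := isBilinearMap_curvature_outer hn (X y) (Y y)
  smooth hU hV := SmoothNear.curvature hn hU hX hY hV

variable (x) in
lemma smoothBilinNear_ricci : SmoothBilinNear x (ricci nabla) where
  bilin _ := isBilinearMap_ricci hn
  smooth hX hY := by
    obtain ⟨F, hF, -⟩ := exists_orthonormalFrameNear (onb I x)
    exact (SmoothFunNear.sum fun i _ ↦
      SmoothNear.curvature hn (hF.smooth i) hX hY (hF.smooth i)).congr (hF.ricci_eventuallyEq hn)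

namespace OrthonormalFrameNear

variable (hF : OrthonormalFrameNear x F) (hmetric : IsMetric nabla)

include hF hmetric

lemma covDerivBilin_ricci (hU : SmoothNear x U) (hX : SmoothNear x X) (hY : SmoothNear x Y) :
    covDerivBilin nabla (ricci nabla) x (U x) (X x) (Y x)
      = ∑ i, inner ℝ (covDerivCurvature nabla U (F i) X Y x) (F i x) := by
  obtain ⟨b, hb⟩ := hF.orthonormal.self_of_nhds
  have hB := smoothBilinNear_curvature_outer hn hX hY
  rw [(smoothBilinNear_ricci x hn).covDerivBilin_apply hX hY,
    mvfderiv_congr (hF.ricci_eventuallyEq hn), hF.mvfderiv_trace hmetric hB, ricci_eq_sum hn b,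
    ricci_eq_sum hn b, ← Finset.sum_sub_distrib, ← Finset.sum_sub_distrib]
  refine Finset.sum_congr rfl fun i _ ↦ ?_
  rw [hb, hB.covDerivBilin_apply (hF.smooth i) (hF.smooth i),
    inner_covDerivCurvature hn hmetric hU (hF.smooth i) hX hY (hF.smooth i)]
  ring

lemma mvfderiv_scal (hU : SmoothNear x U) :
    mvfderiv I (scal nabla) x (U x)
      = ∑ j, ∑ i, inner ℝ (covDerivCurvature nabla U (F i) (F j) (F j) x) (F i x) := by
  rw [mvfderiv_congr (hF.scal_eventuallyEq hn),
    hF.mvfderiv_trace hmetric (smoothBilinNear_ricci x hn)]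
  exact Finset.sum_congr rfl fun j _ ↦
    hF.covDerivBilin_ricci hn hmetric hU (hF.smooth j) (hF.smooth j)

end OrthonormalFrameNear

end Ricci

lemma OrthonormalFrameNear.torsionNormSq_eventuallyEq (hF : OrthonormalFrameNear x F) :
    torsionNormSq nabla
      =ᶠ[𝓝 x] fun y ↦ ∑ i, ∑ j, inner ℝ (nabla.torsion y (F i y) (F j y))
        (nabla.torsion y (F i y) (F j y)) := by
  filter_upwards [hF.orthonormal] with y ⟨b, hb⟩
  simp only [torsionNormSq_eq_sum b, hb, real_inner_self_eq_norm_sq]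

lemma OrthonormalFrameNear.sum_inner_covDerivTorsion (hF : OrthonormalFrameNear x F)
    (hmetric : IsMetric nabla) :
    ∑ i, ∑ j, inner ℝ (covDerivTorsion nabla U (F i) (F j) x) (nabla.torsion x (F i x) (F j x))
      = ∑ i, ∑ j, inner ℝ (nabla (fun y ↦ nabla.torsion y (F i y) (F j y)) x (U x))
        (nabla.torsion x (F i x) (F j x)) := by
  obtain ⟨b, hb⟩ := hF.orthonormal.self_of_nhds
  let τ := (nabla.torsion x).toLinearMap₁₂
  have skew := hF.inner_covDeriv_skew hmetric (U x)
  simp only [← hb] at skew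
  have rotation_left (j : ι) : ∑ i, inner ℝ (nabla.torsion x (nabla (F i) x (U x)) (b j))
      (nabla.torsion x (b i) (b j)) = 0 :=
    sum_inner_map_eq_zero_of_skew (τ.flip (b j)) b skew
  have rotation_right (i : ι) : ∑ j, inner ℝ (nabla.torsion x (b i) (nabla (F j) x (U x)))
      (nabla.torsion x (b i) (b j)) = 0 :=
    sum_inner_map_eq_zero_of_skew (τ (b i)) b skew
  simp only [covDerivTorsion, ← hb, inner_sub_left, Finset.sum_sub_distrib, rotation_right,
    sub_zero]
  rw [sub_eq_self, Finset.sum_comm]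
  simp only [rotation_left, Finset.sum_const_zero]

variable [T2Space M] [IsContMDiffRiemannianBundle I ∞ E (fun x : M ↦ TangentSpace I x)]
  (hn : nabla.ContMDiffCovariantDerivative ∞)

include hn

variable (x) in
lemma smoothFunNear_torsionNormSq : SmoothFunNear I x (torsionNormSq nabla) := by
  obtain ⟨F, hF, -⟩ := exists_orthonormalFrameNear (onb I x)
  have smooth i j := SmoothNear.torsion hn (hF.smooth i) (hF.smooth j)
  exact (SmoothFunNear.sum fun i _ ↦ .sum fun j _ ↦ (smooth i j).inner (smooth i j)).congr
    hF.torsionNormSq_eventuallyEq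

lemma OrthonormalFrameNear.mvfderiv_torsionNormSq (hF : OrthonormalFrameNear x F)
    (hmetric : IsMetric nabla) :
    mvfderiv I (torsionNormSq nabla) x (U x)
      = 2 * ∑ i, ∑ j, inner ℝ (covDerivTorsion nabla U (F i) (F j) x)
        (nabla.torsion x (F i x) (F j x)) := by
  have smooth i j := SmoothNear.torsion hn (hF.smooth i) (hF.smooth j)
  have leibniz i j := hmetric x _ _ (smooth i j).mdifferentiableAt (smooth i j).mdifferentiableAt
    (U x)
  rw [hF.sum_inner_covDerivTorsion hmetric, mvfderiv_congr hF.torsionNormSq_eventuallyEq,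
    mvfderiv_sum fun i _ ↦ SmoothFunNear.sum fun j _ ↦ (smooth i j).inner (smooth i j), sum_apply,
    Finset.mul_sum]
  refine Finset.sum_congr rfl fun i _ ↦ ?_
  rw [mvfderiv_sum fun j _ ↦ (smooth i j).inner (smooth i j), sum_apply, Finset.mul_sum]
  refine Finset.sum_congr rfl fun j _ ↦ ?_
  rw [leibniz, real_inner_comm, two_mul]

end Contractions

section Components

variable {ι : Type*} {T : ι → ι → ι → ℝ} {A R DT : ι → ι → ι → ι → ℝ}
  {DR : ι → ι → ι → ι → ι → ℝ}

/-- An array of components is totally skew-symmetric, as are those of a 3-form. -/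
structure IsThreeForm (T : ι → ι → ι → ℝ) : Prop where
  swap_left : ∀ i j k, T i j k = -T j i k
  swap_right : ∀ i j k, T i j k = -T i k j

/-- An array of components has the symmetries of an element of `S²Λ²`; skew-symmetry in the last
two indices follows. -/
structure IsSymSqTwoForm (A : ι → ι → ι → ι → ℝ) : Prop where
  swap_left : ∀ i j k l, A i j k l = -A j i k l
  pair_symm : ∀ i j k l, A i j k l = A k l i j

lemma IsThreeForm.rotate (hT : IsThreeForm T) (i j k : ι) : T j k i = T i j k := by
  rw [hT.swap_right, hT.swap_left, neg_neg]

lemma IsSymSqTwoForm.swap_right (hA : IsSymSqTwoForm A) (i j k l : ι) :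
    A i j k l = -A i j l k := by
  rw [hA.pair_symm, hA.swap_left, hA.pair_symm]

lemma IsSymSqTwoForm.swap_swap (hA : IsSymSqTwoForm A) (i j k l : ι) :
    A i j k l = A j i l k := by
  rw [hA.swap_left, hA.swap_right, neg_neg]

lemma IsSymSqTwoForm.cyclicSum_swap (hA : IsSymSqTwoForm A) (i j k l : ι) :
    A i j k l + A j k i l + A k i j l = -(A l j k i + A j k l i + A k l j i) := by
  linear_combination hA.pair_symm i j k l + hA.swap_right k l i j + hA.swap_right j k i l
    + hA.pair_symm k i j l + hA.swap_left j l k i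

variable [Fintype ι]

lemma sum_mul_eq_zero_of_symm_of_skew {S K : ι → ι → ℝ} (hS : ∀ i j, S i j = S j i)
    (hK : ∀ i j, K i j = -K j i) : ∑ i, ∑ j, S i j * K i j = 0 := by
  have h : ∑ i, ∑ j, S i j * K i j = -∑ i, ∑ j, S i j * K i j :=
    calc ∑ i, ∑ j, S i j * K i j
      _ = ∑ i, ∑ j, S j i * K j i := Finset.sum_comm
      _ = ∑ i, ∑ j, -(S i j * K i j) :=
        Finset.sum_congr rfl fun i _ ↦ Finset.sum_congr rfl fun j _ ↦ by
          rw [hS j i, hK j i, mul_neg]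
      _ = -∑ i, ∑ j, S i j * K i j := by simp only [Finset.sum_neg_distrib]
  linarith

lemma IsThreeForm.isSymSqTwoForm_sum_mul (hT : IsThreeForm T) :
    IsSymSqTwoForm fun i j k l ↦ ∑ m, T i j m * T m k l where
  swap_left i j k l := by
    simp only [hT.swap_left i j _, neg_mul, Finset.sum_neg_distrib]
  pair_symm i j k l := Finset.sum_congr rfl fun m _ ↦ by
    rw [← hT.rotate m i j, ← hT.rotate m k l, mul_comm]

lemma IsThreeForm.sum_mul_cyclicSum (hT : IsThreeForm T) (A : ι → ι → ι → ℝ) :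
    ∑ i, ∑ j, ∑ k, T i j k * (A i j k + A j k i + A k i j)
      = 3 * ∑ i, ∑ j, ∑ k, T i j k * A i j k := by
  have rotate (A : ι → ι → ι → ℝ) :
      ∑ i, ∑ j, ∑ k, T i j k * A j k i = ∑ i, ∑ j, ∑ k, T i j k * A i j k := by
    rw [← Finset.sum_comm_cycle]
    exact Finset.sum_congr rfl fun i _ ↦ Finset.sum_congr rfl fun j _ ↦
      Finset.sum_congr rfl fun k _ ↦ by rw [← hT.rotate k]
  simp only [mul_add, Finset.sum_add_distrib, rotate A, rotate fun i j k ↦ A j k i]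
  ring

lemma IsThreeForm.sum_mul_sum_mul (hT : IsThreeForm T) (l : ι) :
    ∑ i, ∑ j, ∑ k, T i j k * ∑ m, T i j m * T m k l = 0 := by
  refine Finset.sum_eq_zero fun i _ ↦ Finset.sum_eq_zero fun j _ ↦ ?_
  simp only [Finset.mul_sum, ← mul_assoc]
  exact sum_mul_eq_zero_of_symm_of_skew (fun k m ↦ mul_comm ..) fun k m ↦ hT.swap_left m k l

/-- The components, in an orthonormal basis, of the torsion form `T`, of the curvature `R ∈ S²Λ²`
and of their covariant derivatives `DT` and `DR` (the first index of which is the direction of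
differentiation), related by the two Bianchi identities. -/
structure BianchiComponents (T : ι → ι → ι → ℝ) (R DT : ι → ι → ι → ι → ℝ)
    (DR : ι → ι → ι → ι → ι → ℝ) : Prop where
  torsion : IsThreeForm T
  covDerivTorsion : ∀ l, IsThreeForm (DT l)
  curvature : IsSymSqTwoForm R
  covDerivCurvature : ∀ m, IsSymSqTwoForm (DR m)
  firstBianchi : ∀ i j k l, R i j k l + R j k i l + R k i j l
    = DT i j k l + DT j k i l + DT k i j l
      + (∑ m, T i j m * T m k l + ∑ m, T j k m * T m i l + ∑ m, T k i m * T m j l)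
  secondBianchi : ∀ i j k l m, DR i j k l m + DR j k i l m + DR k i j l m
      + (∑ n, T i j n * R n k l m + ∑ n, T j k n * R n i l m + ∑ n, T k i n * R n j l m) = 0

namespace BianchiComponents

variable (h : BianchiComponents T R DT DR)

include h

/- Both curvature-like tensors in the first Bianchi identity have cyclic sums which are skew in the
first and last index; hence so has `DT`. -/
lemma covDerivTorsion_swap (i j k l : ι) : DT i j k l = -DT l j k i := by
  have hDT := h.covDerivTorsion
  linear_combination h.curvature.cyclicSum_swap i j k l
    - h.torsion.isSymSqTwoForm_sum_mul.cyclicSum_swap i j k l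
    - h.firstBianchi i j k l - h.firstBianchi l j k i
    - (hDT j).swap_right k i l - (hDT k).swap_left i j l + (hDT k).rotate l j i

lemma sum_torsion_mul_curvature (l : ι) :
    ∑ i, ∑ j, ∑ k, T i j k * R i j k l = -∑ i, ∑ j, ∑ k, T i j k * DT l i j k := by
  have first_bianchi (i j k : ι) : R i j k l + R j k i l + R k i j l
      = (∑ m, T i j m * T m k l + ∑ m, T j k m * T m i l + ∑ m, T k i m * T m j l)
        - (DT l i j k + DT l j k i + DT l k i j) := by
    rw [h.firstBianchi, h.covDerivTorsion_swap i, h.covDerivTorsion_swap j,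
      h.covDerivTorsion_swap k]
    ring
  have contracted := h.torsion.sum_mul_cyclicSum fun i j k ↦ R i j k l
  simp only [first_bianchi, mul_sub, Finset.sum_sub_distrib,
    h.torsion.sum_mul_cyclicSum fun i j k ↦ DT l i j k,
    h.torsion.sum_mul_cyclicSum fun i j k ↦ ∑ m, T i j m * T m k l,
    h.torsion.sum_mul_sum_mul] at contracted
  linarith

lemma sum_torsion_mul_ricci (l : ι) : ∑ i, ∑ n, T i l n * ∑ j, R j n i j = 0 := by
  simp only [mul_comm (T _ _ _)]
  refine sum_mul_eq_zero_of_symm_of_skew (fun i n ↦ Finset.sum_congr rfl fun j _ ↦ ?_)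
    fun i n ↦ ?_
  · rw [h.curvature.pair_symm, h.curvature.swap_swap]
  · rw [h.torsion.swap_left, h.torsion.rotate, h.torsion.rotate]

theorem contractedSecondBianchi (l : ι) :
    ∑ j, ∑ i, DR l i j j i - 2 * ∑ i, ∑ j, DR i j l i j
      = -∑ i, ∑ j, ∑ k, T i j k * DT l i j k := by
  have second_bianchi (i j : ι) : DR i j l i j - DR l i j j i + DR j i l j i
      + (∑ n, T i l n * R j n i j + ∑ n, T j l n * R i n j i + ∑ n, T j i n * R j i n l) = 0 := by
    rw [← h.secondBianchi i l j j i, (h.covDerivCurvature i).swap_swap l,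
      (h.covDerivCurvature l).swap_left j, ← sub_eq_add_neg]
    simp only [h.curvature.swap_swap _ j j i, h.torsion.swap_left l j _,
      h.curvature.swap_left _ i j i, neg_mul_neg, h.curvature.pair_symm _ l j i]
  have ricci_left : ∑ i, ∑ j, ∑ n, T i l n * R j n i j = 0 := by
    rw [← h.sum_torsion_mul_ricci l]
    refine Finset.sum_congr rfl fun i _ ↦ ?_
    rw [Finset.sum_comm]
    simp only [Finset.mul_sum]
  have ricci_right : ∑ i, ∑ j, ∑ n, T j l n * R i n j i = 0 := by
    rw [Finset.sum_comm, ricci_left]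
  have torsion_curvature : ∑ i, ∑ j, ∑ n, T j i n * R j i n l
      = -∑ i, ∑ j, ∑ k, T i j k * DT l i j k := by
    rw [Finset.sum_comm, h.sum_torsion_mul_curvature]
  have swap_DR : ∑ i, ∑ j, DR j i l j i = ∑ i, ∑ j, DR i j l i j := Finset.sum_comm
  have contracted := Finset.sum_eq_zero fun i (_ : i ∈ Finset.univ) ↦
    Finset.sum_eq_zero fun j (_ : j ∈ Finset.univ) ↦ second_bianchi i j
  simp only [Finset.sum_add_distrib, Finset.sum_sub_distrib, ricci_left, ricci_right,
    torsion_curvature, swap_DR] at contracted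
  rw [Finset.sum_comm]
  linarith

end BianchiComponents

end Components

section ContractedBianchi

variable {E : Type*} [NormedAddCommGroup E] [NormedSpace ℝ E] [FiniteDimensional ℝ E]
  {H : Type*} [TopologicalSpace H] {I : ModelWithCorners ℝ E H}
  {M : Type*} [TopologicalSpace M] [ChartedSpace H M] [IsManifold I ∞ M]
  [RiemannianBundle (fun x : M ↦ TangentSpace I x)]
  {x : M} {ι : Type*} [Fintype ι] {F : ι → Π y : M, TangentSpace I y}
  {nabla : CovariantDerivative I E (TangentSpace I : M → Type _)}

lemma torsionForm_torsion_eq_sum (b : OrthonormalBasis ι ℝ (TangentSpace I x))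
    (u v w z : TangentSpace I x) :
    torsionForm nabla x (nabla.torsion x u v) w z
      = ∑ m, torsionForm nabla x u v (b m) * torsionForm nabla x (b m) w z := by
  let τ := (nabla.torsion x).toLinearMap₁₂
  rw [torsionForm, show nabla.torsion x (nabla.torsion x u v) w
    = ∑ m, inner ℝ (b m) (nabla.torsion x u v) • nabla.torsion x (b m) w from
      map_eq_sum_inner_smul (τ.flip w) b _, sum_inner]
  simp only [torsionForm, real_inner_smul_left, real_inner_comm (b _)]

variable [T2Space M] (hn : nabla.ContMDiffCovariantDerivative ∞)

include hn

lemma curvature_torsion_eq_sum (b : OrthonormalBasis ι ℝ (TangentSpace I x))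
    (s t u v w : TangentSpace I x) :
    curvature nabla x (nabla.torsion x s t) u v w
      = ∑ n, torsionForm nabla x s t (b n) * curvature nabla x (b n) u v w := by
  simp only [torsionForm, real_inner_comm (b _)]
  exact map_eq_sum_inner_smul ((isBilinearMap_curvature_outer hn u v).toLinearMap.flip w) b _

variable (hmetric : IsMetric nabla) (hT : HasSkewTorsion nabla) (hR : CurvaturePairSymmetric nabla)

include hmetric hT hR

lemma OrthonormalFrameNear.bianchiComponents (hF : OrthonormalFrameNear x F) :
    BianchiComponents (fun i j k ↦ torsionForm nabla x (F i x) (F j x) (F k x))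
      (fun i j k l ↦ curvature nabla x (F i x) (F j x) (F k x) (F l x))
      (fun l i j k ↦ inner ℝ (covDerivTorsion nabla (F l) (F i) (F j) x) (F k x))
      (fun m i j k l ↦
        inner ℝ (covDerivCurvature nabla (F m) (F i) (F j) (F k) x) (F l x)) where
  torsion :=
    { swap_left := fun i j k ↦ (hT x _ _ _).1
      swap_right := fun i j k ↦ (hT x _ _ _).2 }
  covDerivTorsion l :=
    { swap_left := fun i j k ↦ by
        rw [SkewTorsion.covDerivTorsion_swap hn (hF.smooth i) (hF.smooth j), inner_neg_left]
      swap_right := fun i j k ↦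
        hT.inner_covDerivTorsion_swap hn hmetric (hF.smooth i) (hF.smooth j) (hF.smooth k) }
  curvature :=
    { swap_left := fun i j k l ↦ by
        simp only [curvature, curvatureField_swap (X := ext (F i x)), inner_neg_left]
      pair_symm := fun i j k l ↦ hR x _ _ _ _ }
  covDerivCurvature m :=
    { swap_left := fun i j k l ↦ by
        rw [covDerivCurvature_swap hn (hF.smooth i) (hF.smooth j) (hF.smooth k), inner_neg_left]
      pair_symm := fun i j k l ↦ hR.inner_covDerivCurvature_comm hn hmetric (hF.smooth m)
        (hF.smooth i) (hF.smooth j) (hF.smooth k) (hF.smooth l) }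
  firstBianchi i j k l := by
    obtain ⟨b, hb⟩ := hF.orthonormal.self_of_nhds
    have bianchi := congrArg (inner ℝ · (F l x))
      (firstBianchi hn (hF.smooth i) (hF.smooth j) (hF.smooth k))
    simp only [inner_add_left, ← curvature_eq_inner hn (hF.smooth _) (hF.smooth _) (hF.smooth _)]
      at bianchi
    simp only [← hb, ← torsionForm_torsion_eq_sum b] at bianchi ⊢
    rw [bianchi]
    simp only [torsionForm]
    ring
  secondBianchi i j k l m := by
    obtain ⟨b, hb⟩ := hF.orthonormal.self_of_nhds
    have torsion_curvature (i j k) := curvature_eq_inner hn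
      (SmoothNear.torsion hn (hF.smooth i) (hF.smooth j)) (hF.smooth k) (hF.smooth l) (F m x)
    have bianchi := congrArg (inner ℝ · (F m x))
      (secondBianchi hn (hF.smooth i) (hF.smooth j) (hF.smooth k) (hF.smooth l))
    simp only [inner_add_left, inner_zero_left, ← torsion_curvature] at bianchi
    simp only [← hb, ← curvature_torsion_eq_sum hn b] at bianchi ⊢
    rw [← bianchi]
    ring

variable [IsContMDiffRiemannianBundle I ∞ E (fun x : M ↦ TangentSpace I x)]

lemma OrthonormalFrameNear.contractedSecondBianchi_defect (hF : OrthonormalFrameNear x F) (l : ι) :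
    mvfderiv I (scal nabla) x (F l x)
        - 2 * ∑ i, covDerivBilin nabla (ricci nabla) x (F i x) (F l x) (F i x)
      = -(1 / 2) * mvfderiv I (torsionNormSq nabla) x (F l x) := by
  obtain ⟨b, hb⟩ := hF.orthonormal.self_of_nhds
  have components := hF.bianchiComponents hn hmetric hT hR
  have norm_sq : mvfderiv I (torsionNormSq nabla) x (F l x)
      = 2 * ∑ i, ∑ j, ∑ k, torsionForm nabla x (F i x) (F j x) (F k x)
        * inner ℝ (covDerivTorsion nabla (F l) (F i) (F j) x) (F k x) := by
    rw [hF.mvfderiv_torsionNormSq hn hmetric]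
    congr! 5 with i _ j _
    rw [real_inner_comm, ← b.sum_inner_mul_inner]
    simp only [hb, torsionForm, real_inner_comm (covDerivTorsion ..)]
  rw [hF.mvfderiv_scal hn hmetric (hF.smooth l), norm_sq]
  simp only [hF.covDerivBilin_ricci hn hmetric (hF.smooth _) (hF.smooth _) (hF.smooth _)]
  rw [components.contractedSecondBianchi]
  ring

theorem contractedSecondBianchi_defect (u : TangentSpace I x) :
    mvfderiv I (scal nabla) x u
        - 2 * ∑ i, covDerivBilin nabla (ricci nabla) x (onb I x i) u (onb I x i)
      = -(1 / 2) * mvfderiv I (torsionNormSq nabla) x u := by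
  obtain ⟨F, hF, hFx⟩ := exists_orthonormalFrameNear (onb I x)
  let divRicci : TangentSpace I x →ₗ[ℝ] ℝ := ∑ i, ((smoothBilinNear_ricci x hn)
    |>.isLinearMap_covDerivBilin (nabla := nabla) (onb I x i) (onb I x i)).mk'
  have eq_linear : (mvfderiv I (scal nabla) x).toLinearMap - (2 : ℝ) • divRicci
      = -(1 / 2 : ℝ) • (mvfderiv I (torsionNormSq nabla) x).toLinearMap := by
    refine (onb I x).toBasis.ext fun l ↦ ?_
    simpa [divRicci, hFx] using hF.contractedSecondBianchi_defect hn hmetric hT hR l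
  simpa [divRicci] using LinearMap.congr_fun eq_linear u

end ContractedBianchi

section Constancy

variable {E : Type*} [NormedAddCommGroup E] [NormedSpace ℝ E]
  {H : Type*} [TopologicalSpace H] {I : ModelWithCorners ℝ E H}
  {M : Type*} [TopologicalSpace M] [ChartedSpace H M] [IsManifold I 1 M] {f : M → ℝ}

lemma hasFDerivWithinAt_comp_extChartAt_symm (hf : MDiff f) (h : ∀ x, mvfderiv I f x = 0)
    (x : M) {z : E} (hz : z ∈ (extChartAt I x).target) :
    HasFDerivWithinAt (f ∘ (extChartAt I x).symm) (0 : E →L[ℝ] ℝ) (Set.range I) z := by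
  have hasMFDeriv : HasMFDerivAt I 𝓘(ℝ, ℝ) f ((extChartAt I x).symm z) 0 := by
    have mfderiv_eq : mfderiv I 𝓘(ℝ, ℝ) f ((extChartAt I x).symm z) = 0 := h _
    simpa only [mfderiv_eq] using (hf ((extChartAt I x).symm z)).hasMFDerivAt
  simpa using! (hasMFDeriv.comp_hasMFDerivWithinAt z
    (mdifferentiableWithinAt_extChartAt_symm hz).hasMFDerivWithinAt).hasFDerivWithinAt

lemma isLocallyConstant_of_mvfderiv_eq_zero (hf : MDiff f) (h : ∀ x, mvfderiv I f x = 0) :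
    IsLocallyConstant f := by
  rw [IsLocallyConstant.iff_eventually_eq]
  intro x
  obtain ⟨r, hr, ball_subset⟩ :=
    Metric.mem_nhdsWithin_iff.1 (extChartAt_target_mem_nhdsWithin (I := I) x)
  set s := Metric.ball (extChartAt I x x) r ∩ Set.range I
  have hasFDeriv : ∀ z ∈ s, HasFDerivWithinAt (f ∘ (extChartAt I x).symm) 0 s z := fun z hz ↦
    (hasFDerivWithinAt_comp_extChartAt_symm hf h x (ball_subset hz)).mono Set.inter_subset_right
  have convex : Convex ℝ s := (convex_ball _ r).inter I.convex_range
  have eventually_mem_ball := (continuousAt_extChartAt (I := I) x).eventually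
    (Metric.ball_mem_nhds _ hr)
  filter_upwards [eventually_mem_ball, extChartAt_source_mem_nhds (I := I) x]
    with y y_mem_ball y_mem_source
  have norm_sub_le := convex.norm_image_sub_le_of_norm_hasFDerivWithin_le hasFDeriv
    (fun _ _ ↦ norm_zero.le)
    ⟨Metric.mem_ball_self hr, extChartAt_target_subset_range x (mem_extChartAt_target x)⟩
    ⟨y_mem_ball, extChartAt_target_subset_range x ((extChartAt I x).map_source y_mem_source)⟩
  simpa only [Function.comp_apply, (extChartAt I x).left_inv y_mem_source, extChartAt_to_inv,
    zero_mul, norm_le_zero_iff, sub_eq_zero] using norm_sub_le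

end Constancy

section RicciFlat

variable {E : Type*} [NormedAddCommGroup E] [NormedSpace ℝ E] [FiniteDimensional ℝ E]
  {H : Type*} [TopologicalSpace H] {I : ModelWithCorners ℝ E H}
  {M : Type*} [TopologicalSpace M] [ChartedSpace H M] [IsManifold I 1 M]
  [RiemannianBundle (fun x : M ↦ TangentSpace I x)]
  {nabla : CovariantDerivative I E (TangentSpace I : M → Type _)}

lemma RicciFlat.contractedSecondBianchi (h : RicciFlat nabla) : ContractedSecondBianchi nabla := by
  intro x u
  have ricci_eq : ricci nabla = fun _ _ _ ↦ 0 := funext fun y ↦ funext₂ (h y)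
  have scal_eq : scal nabla = fun _ ↦ 0 := funext fun y ↦ Finset.sum_eq_zero fun i _ ↦ h y _ _
  simp [scal_eq, ricci_eq, covDerivBilin, mvfderiv_const]

end RicciFlat

end SkewTorsion

end

theorem mainTheorem5_general
    {E : Type*} [NormedAddCommGroup E] [NormedSpace ℝ E] [FiniteDimensional ℝ E]
    {H : Type*} [TopologicalSpace H] {I : ModelWithCorners ℝ E H}
    {M : Type*} [TopologicalSpace M] [T2Space M] [PreconnectedSpace M]
    [ChartedSpace H M] [IsManifold I ∞ M]
    [RiemannianBundle (fun x : M ↦ TangentSpace I x)]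
    [IsContMDiffRiemannianBundle I ∞ E (fun x : M ↦ TangentSpace I x)]
    (nabla : CovariantDerivative I E (TangentSpace I : M → Type _))
    (hsmooth : nabla.ContMDiffCovariantDerivative ∞)
    (hmetric : SkewTorsion.IsMetric nabla)
    (hskew : SkewTorsion.HasSkewTorsion nabla)
    (hR : SkewTorsion.CurvaturePairSymmetric nabla) :
    (SkewTorsion.ContractedSecondBianchi nabla ↔
      ∃ c : ℝ, ∀ x : M, SkewTorsion.torsionNormSq nabla x = c) ∧
    (SkewTorsion.RicciFlat nabla →
      ∃ c : ℝ, ∀ x : M, SkewTorsion.torsionNormSq nabla x = c) := by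
  have defect (x : M) (u : TangentSpace I x) :=
    SkewTorsion.contractedSecondBianchi_defect hsmooth hmetric hskew hR u
  have bianchi_iff : SkewTorsion.ContractedSecondBianchi nabla ↔
      ∃ c : ℝ, ∀ x : M, SkewTorsion.torsionNormSq nabla x = c := by
    constructor
    · intro bianchi
      have mvfderiv_eq_zero (x : M) : mvfderiv I (SkewTorsion.torsionNormSq nabla) x = 0 := by
        ext u
        simpa [bianchi x u] using defect x u
      have mdiff : MDiff (SkewTorsion.torsionNormSq nabla) := fun x ↦
        (SkewTorsion.smoothFunNear_torsionNormSq x hsmooth).mdifferentiableAt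
      have locally_constant := SkewTorsion.isLocallyConstant_of_mvfderiv_eq_zero mdiff
        mvfderiv_eq_zero
      exact locally_constant.exists_eq_const.imp fun c ↦ congrFun
    · rintro ⟨c, hc⟩ x u
      rw [defect, funext hc, mvfderiv_const, zero_apply, mul_zero]
  exact ⟨bianchi_iff, fun flat ↦ bianchi_iff.1 flat.contractedSecondBianchi⟩

theorem mainTheorem5
    {E : Type*} [NormedAddCommGroup E] [NormedSpace ℝ E] [FiniteDimensional ℝ E]
    {H : Type*} [TopologicalSpace H] {I : ModelWithCorners ℝ E H} [I.Boundaryless]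
    {M : Type*} [TopologicalSpace M] [T2Space M] [ConnectedSpace M]
    [ChartedSpace H M] [IsManifold I ∞ M]
    [RiemannianBundle (fun x : M ↦ TangentSpace I x)]
    [IsContMDiffRiemannianBundle I ∞ E (fun x : M ↦ TangentSpace I x)]
    (nabla : CovariantDerivative I E (TangentSpace I : M → Type _))
    (hsmooth : nabla.ContMDiffCovariantDerivative ∞)
    (hmetric : SkewTorsion.IsMetric nabla)
    (hskew : SkewTorsion.HasSkewTorsion nabla)
    (hR : SkewTorsion.CurvaturePairSymmetric nabla) :
    (SkewTorsion.ContractedSecondBianchi nabla ↔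
      ∃ c : ℝ, ∀ x : M, SkewTorsion.torsionNormSq nabla x = c) ∧
    (SkewTorsion.RicciFlat nabla →
      ∃ c : ℝ, ∀ x : M, SkewTorsion.torsionNormSq nabla x = c) :=
  mainTheorem5_general nabla hsmooth hmetric hskew hR
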